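/- Consider a game with $N\ge 2$ players. Player $i$ has an action $x_i\in\mathbb R$ and a $C^2$ cost function $f_i:\mathbb R^N\to\mathbb R$; write $\nabla_i f_i=\partial f_i/\partial x_i$. Assume that the pseudo-gradient $\mathcal P(\mathbf x)=(\nabla_1 f_1(\mathbf x),\dots,\nabla_N f_N(\mathbf x))$ is strongly monotone: there is $m>0$ with $(\mathbf x-\mathbf z)^T(\mathcal P(\mathbf x)-\mathcal P(\mathbf z))\ge m\|\mathbf x-\mathbf z\|^2$ for all $\mathbf x,\mathbf z\in\mathbb R^N$. Let $\mathcal G$ be a connected undirected graph on the players with a symmetric adjacency matrix $(a_{ij})$, where $a_{ij}>0$ if $i,j$ are adjacent and $a_{ij}=0$ otherwise (in particular $a_{ii}=0$). Let $\bar U>0$, let $K_i>0$ and $\bar\theta_{ij}>0$ ($i,j=1,\dots,N$) be fixed constants, and put $\rho_{\bar U}(s)=\operatorname{sgn}(s)\min\{|s|,\bar U\}$. For gains $\theta,\theta_1>0$ the players, which are second-order integrators, follow the distributed strategy with saturated controls $$\dot x_i=\nu_i,\qquad \dot\nu_i=-\rho_{\bar U}\big((x_i-z_i)+(\nu_i-\dot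 z_i)\big),\qquad \dot z_i=-\theta_1K_i\nabla_if_i(\mathbf y_i),$$ $$\dot y_{ij}=-\theta\theta_1\bar\theta_{ij}\Big(\sum_{k=1}^N a_{ik}(y_{ij}-y_{kj})+a_{ij}(y_{ij}-z_j)\Big),\qquad i,j=1,\dots,N,$$ where $\mathbf y_i=(y_{i1},\dots,y_{iN})$ is player $i$'s estimate of all the actions and $\mathbf y=(y_{11},y_{12},\dots,y_{NN})$. Then the game has a unique Nash equilibrium $\mathbf x^*$ (that is, $f_i(\mathbf x^*)\le f_i(x_i,\mathbf x^*_{-i})$ for all $i$ and all $x_i\in\mathbb R$), and for every $\Delta>0$ there is $\theta^*>0$ such that for every $\theta>\theta^*$ there is $\theta_1^*=\theta_1^*(\Delta,\theta)>0$ such that for every $\theta_1\in(0,\theta_1^*)$ the following holds. From every initial state with $$\big\|\big(\boldsymbol\nu(0)-\dot{\mathbf z}(0),\ \mathbf x(0)-\mathbf z(0),\ \mathbf y(0)-\mathbf 1_N\otimes\mathbf z(0),\ \mathbf z(0)-\mathbf x^*\big)\big\|\le\Delta$$ the system has a solution on $[0,\infty)$, and every such solution satisfies $\mathbf x(t)\to\mathbf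 x^*$ as $t\to\infty$. -/

import Mathlib

namespace BoundedNash

/-- A profile `x` of the `N`-player game with costs `f` is a Nash equilibrium: no player can
decrease its own cost by changing its own action alone. -/
def IsNashEquilibrium {N : ℕ} (f : Fin N → (Fin N → ℝ) → ℝ) (x : Fin N → ℝ) : Prop :=
  ∀ (i : Fin N) (s : ℝ), f i x ≤ f i (Function.update x i s)

/-- `∂ f_i / ∂ x_i` at `x`: the derivative of the cost of player `i` in its own action. -/
noncomputable def ownPartial {N : ℕ} (f : Fin N → (Fin N → ℝ) → ℝ) (i : Fin N)
    (x : Fin N → ℝ) : ℝ :=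
  deriv (fun s : ℝ => f i (Function.update x i s)) (x i)

/-- The pseudo-gradient `x ↦ (∂ f_i / ∂ x_i (x))_i` is strongly monotone with constant `m`
(Euclidean inner product and norm). -/
def StronglyMonotoneWith {N : ℕ} (f : Fin N → (Fin N → ℝ) → ℝ) (m : ℝ) : Prop :=
  ∀ x z : Fin N → ℝ,
    m * ∑ i, (x i - z i) ^ 2 ≤ ∑ i, (x i - z i) * (ownPartial f i x - ownPartial f i z)

/-- `A` is a (possibly weighted) adjacency matrix of the undirected graph `G`: symmetric,
positive on edges, zero elsewhere (in particular on the diagonal). The unweighted adjacency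
matrix of `G` is the case in which all edges have weight `1`. -/
structure IsAdjacencyMatrix {N : ℕ} (G : SimpleGraph (Fin N))
    (A : Matrix (Fin N) (Fin N) ℝ) : Prop where
  symm : ∀ i j, A i j = A j i
  pos : ∀ i j, G.Adj i j → 0 < A i j
  zero : ∀ i j, ¬ G.Adj i j → A i j = 0

/-- The saturation function `sgn(s) min{|s|, U}`. -/
noncomputable def sat (U s : ℝ) : ℝ := Real.sign s * min |s| U

/-- Right-hand side of the dynamics of `z`:
`ż_i = -θ₁ K_i ∂ f_i / ∂ x_i (y_i)`, where `y_i` is player `i`'s estimate of all actions. -/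
noncomputable def zRate {N : ℕ} (f : Fin N → (Fin N → ℝ) → ℝ) (K : Fin N → ℝ) (θ₁ : ℝ)
    (y : Fin N → Fin N → ℝ) : Fin N → ℝ :=
  fun i => -(θ₁ * K i) * ownPartial f i (y i)

/-- Right-hand side of the dynamics of the estimates:
`ẏ_ij = -θ θ₁ θbar_ij (∑_k a_ik (y_ij - y_kj) + a_ij (y_ij - z_j))`. -/
def yRate {N : ℕ} (A : Matrix (Fin N) (Fin N) ℝ) (θbar : Fin N → Fin N → ℝ) (θ θ₁ : ℝ)
    (z : Fin N → ℝ) (y : Fin N → Fin N → ℝ) : Fin N → Fin N → ℝ :=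
  fun i j => -(θ * θ₁ * θbar i j) *
    (∑ k, A i k * (y i j - y k j) + A i j * (y i j - z j))

/-- The saturated control `u_i = -ρ_U((x_i - z_i) + (ν_i - ż_i))`. -/
noncomputable def control {N : ℕ} (f : Fin N → (Fin N → ℝ) → ℝ) (K : Fin N → ℝ) (U θ₁ : ℝ)
    (x ν z : Fin N → ℝ) (y : Fin N → Fin N → ℝ) : Fin N → ℝ :=
  fun i => -sat U ((x i - z i) + (ν i - zRate f K θ₁ y i))

/-- `(x, ν, z, y)` is a solution on `[0, ∞)` of the closed loop of the second-order integrators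
with the distributed strategy with saturated controls. -/
structure IsSolution {N : ℕ} (f : Fin N → (Fin N → ℝ) → ℝ) (A : Matrix (Fin N) (Fin N) ℝ)
    (K : Fin N → ℝ) (θbar : Fin N → Fin N → ℝ) (U θ θ₁ : ℝ)
    (x ν z : ℝ → Fin N → ℝ) (y : ℝ → Fin N → Fin N → ℝ) : Prop where
  hasDeriv_x : ∀ t : ℝ, 0 ≤ t → HasDerivWithinAt x (ν t) (Set.Ici 0) t
  hasDeriv_ν : ∀ t : ℝ, 0 ≤ t →
    HasDerivWithinAt ν (control f K U θ₁ (x t) (ν t) (z t) (y t)) (Set.Ici 0) t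
  hasDeriv_z : ∀ t : ℝ, 0 ≤ t → HasDerivWithinAt z (zRate f K θ₁ (y t)) (Set.Ici 0) t
  hasDeriv_y : ∀ t : ℝ, 0 ≤ t →
    HasDerivWithinAt y (yRate A θbar θ θ₁ (z t) (y t)) (Set.Ici 0) t

/-- Euclidean norm of the stacked error `(ν - ż, x - z, y - 1 ⊗ z, z - xs)` of a state. -/
noncomputable def errorNorm {N : ℕ} (f : Fin N → (Fin N → ℝ) → ℝ) (K : Fin N → ℝ) (θ₁ : ℝ)
    (xs : Fin N → ℝ) (x ν z : Fin N → ℝ) (y : Fin N → Fin N → ℝ) : ℝ :=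
  Real.sqrt (∑ i, (ν i - zRate f K θ₁ y i) ^ 2 + ∑ i, (x i - z i) ^ 2
    + ∑ i, ∑ j, (y i j - z j) ^ 2 + ∑ i, (z i - xs i) ^ 2)

end BoundedNash

/-!
The pair `(z, y)` evolves on its own and drives the double integrators `(x, ν)`, so the closed loop
is a cascade, and the two stages are treated separately.

*Equilibrium.* Strong monotonicity makes each cost convex in the player's own action, so Nash
equilibria are the zeros of the pseudo-gradient `P`. A minimum of `|P| ^ 2` exists by coercivity,
and it is a zero because the derivative of `P` is positive definite
(`exists_ownPartial_eq_zero`). Strong monotonicity gives uniqueness.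

*Slow subsystem.* The estimation error `y - 1 ⊗ z` is damped at rate `θ` by graph Laplacians that
are grounded at the neighbours of a vertex, hence positive definite
(`IsAdjacencyMatrix.exists_coercive`), and strong monotonicity damps `z - xs`. The cross terms are
controlled by the Lipschitz constant of `P`, which is finite on sublevel sets of the weighted
quadratic function `lyapunov`; for `θ` large, depending on the level and so on `Δ`, the sublevel set
is invariant and `lyapunov` decays exponentially (`exists_gain`, `lyapunov_le_exp`). The
invariance argument needs the gradients only inside the sublevel set. Applied to the closed loop
with globally Lipschitz extensions of the gradients, it shows that the global solution of that
system solves the original one.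

*Fast subsystem.* With `p = x - z` and `q = ν - ż`, the loop is the double integrator
`ṗ = q`, `q̇ = -sat U (p + q) - z̈`, where `z̈` decays exponentially. The energy of the undisturbed
loop, the primitive of the saturation plus `q ^ 2 / 2`, stays bounded because the disturbance is
integrable; on a bounded set the saturation dominates a linear feedback, and `p` tends to zero
(`tendsto_zero_of_saturated_double_integrator`).
-/

namespace BoundedNash

open Set Filter Topology
open scoped NNReal

/-! ### Global solutions and comparison with exponentials -/

/-- A vector field with a global Lipschitz constant admits a solution on the whole half-line from
every initial state. Picard–Lindelöf gives a time step that does not depend on the initial state,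
and the steps are concatenated. -/
theorem exists_solution_of_lipschitzWith {E : Type*} [NormedAddCommGroup E] [NormedSpace ℝ E]
    [CompleteSpace E] {F : E → E} {L : ℝ≥0} (hF : LipschitzWith L F) (x₀ : E) :
    ∃ α : ℝ → E, α 0 = x₀ ∧ ∀ t, 0 ≤ t → HasDerivWithinAt α (F (α t)) (Ici 0) t := by
  obtain ⟨h, hh, hhL⟩ : ∃ h : ℝ, 0 < h ∧ (1 + L) * h = 1 :=
    ⟨(1 + L)⁻¹, by positivity, mul_inv_cancel₀ (by positivity)⟩
  have loc : ∀ x : E, ∃ β : ℝ → E, β 0 = x ∧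
      ∀ t ∈ Icc 0 h, HasDerivWithinAt β (F (β t)) (Icc 0 h) t := by
    intro x
    have hpl : IsPicardLindelof (fun _ ↦ F) (⟨0, le_rfl, hh.le⟩ : Icc (0 : ℝ) h) x ‖F x‖₊ 0
        ((1 + L) * ‖F x‖₊) L := by
      refine IsPicardLindelof.of_time_independent (fun y hy ↦ ?_) hF.lipschitzOnWith ?_
      · have h1 := hF.dist_le_mul y x
        have h2 : dist y x ≤ ‖F x‖ := by simpa using hy
        have h3 : ‖F y‖ ≤ ‖F x‖ + dist (F y) (F x) := by
          rw [dist_eq_norm]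
          simpa [add_comm] using norm_add_le (F y - F x) (F x)
        have h4 : (L : ℝ) * dist y x ≤ L * ‖F x‖ := by gcongr
        push_cast
        linarith
      · simp only [sub_zero, sub_self, max_eq_left hh.le]
        push_cast
        nlinarith [norm_nonneg (F x)]
    simpa using hpl.exists_eq_forall_mem_Icc_hasDerivWithinAt₀
  choose β hβ0 hβ using loc
  let X : ℕ → E := fun n ↦ Nat.rec x₀ (fun _ x ↦ β x h) n
  let α : ℝ → E := fun t ↦ β (X ⌊t / h⌋₊) (t - ⌊t / h⌋₊ * h)
  have hα : ∀ n : ℕ, ∀ t ∈ Icc (n * h) ((n + 1) * h), α t = β (X n) (t - n * h) := by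
    intro n t ht
    rcases ht.2.lt_or_eq with hlt | heq
    · have : ⌊t / h⌋₊ = n := by
        rw [Nat.floor_eq_iff (div_nonneg ((by positivity : (0 : ℝ) ≤ n * h).trans ht.1) hh.le)]
        exact ⟨(le_div_iff₀ hh).2 ht.1, (div_lt_iff₀ hh).2 hlt⟩
      simp only [α, this]
    · have : ⌊t / h⌋₊ = n + 1 := by
        rw [heq, mul_div_cancel_right₀ _ hh.ne']
        exact_mod_cast Nat.floor_natCast (n + 1)
      simp only [α, this]
      have e1 : t - ((n + 1 : ℕ) : ℝ) * h = 0 := by push_cast; linarith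
      have e2 : t - n * h = h := by linarith
      rw [e1, e2, hβ0]
  have hd : ∀ n : ℕ, ∀ t ∈ Icc (n * h) ((n + 1) * h),
      HasDerivWithinAt α (F (α t)) (Icc (n * h) ((n + 1) * h)) t := by
    intro n t ht
    have h1 : t - n * h ∈ Icc 0 h := ⟨by linarith [ht.1], by linarith [ht.2]⟩
    have h3 : MapsTo (fun s ↦ s - n * h) (Icc (n * h) ((n + 1) * h)) (Icc 0 h) :=
      fun s hs ↦ ⟨by linarith [hs.1], by linarith [hs.2]⟩
    have h2 := (hβ (X n) _ h1).scomp t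
      ((hasDerivAt_id' t).sub_const (n * h)).hasDerivWithinAt h3
    rw [hα n t ht]
    simpa using h2.congr_of_mem (fun s hs ↦ hα n s hs) ht
  refine ⟨α, by simp [α, X, hβ0], fun t ht ↦ ?_⟩
  have hright : HasDerivWithinAt α (F (α t)) (Ici t) t := by
    have h1 : (⌊t / h⌋₊ : ℝ) * h ≤ t := (le_div_iff₀ hh).1 (Nat.floor_le (by positivity))
    have h2 : t < ((⌊t / h⌋₊ : ℝ) + 1) * h := (div_lt_iff₀ hh).1 (Nat.lt_floor_add_one _)
    exact (hd _ t ⟨h1, h2.le⟩).mono_of_mem_nhdsWithin (Icc_mem_nhdsGE_of_mem ⟨h1, h2⟩)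
  rcases ht.eq_or_lt with rfl | hpos
  · exact hright
  have hleft : HasDerivWithinAt α (F (α t)) (Iic t) t := by
    obtain ⟨n, hn⟩ : ∃ n, ⌈t / h⌉₊ = n + 1 :=
      Nat.exists_eq_succ_of_ne_zero (Nat.ceil_pos.2 (by positivity)).ne'
    have h1 : (n : ℝ) * h < t := by
      have := Nat.lt_ceil.1 (show n < ⌈t / h⌉₊ by omega)
      exact (lt_div_iff₀ hh).1 this
    have h2 : t ≤ ((n : ℝ) + 1) * h := by
      have := Nat.le_ceil (t / h)
      rw [hn] at this
      push_cast at this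
      exact (div_le_iff₀ hh).1 this
    exact (hd _ t ⟨h1.le, h2⟩).mono_of_mem_nhdsWithin (Icc_mem_nhdsLE_of_mem ⟨h1, h2⟩)
  have := hleft.union hright
  rw [Iic_union_Ici] at this
  exact this.mono (subset_univ _)

/-- Fencing on the half-line: `V` stays below `B` if it starts below `B` and its derivative is
smaller than that of `B` wherever the two meet. -/
theorem le_of_deriv_lt_at_contact {V V' B B' : ℝ → ℝ}
    (hV : ∀ t, 0 ≤ t → HasDerivWithinAt V (V' t) (Ici 0) t) (hB : ∀ t, HasDerivAt B (B' t) t)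
    (h0 : V 0 ≤ B 0) (hlt : ∀ t, 0 ≤ t → V t = B t → V' t < B' t) :
    ∀ t, 0 ≤ t → V t ≤ B t := by
  intro t ht
  refine image_le_of_deriv_right_lt_deriv_boundary' (a := 0) (b := t) (f' := V') (B' := B')
    (fun s hs ↦ ((hV s hs.1).continuousWithinAt).mono Icc_subset_Ici_self)
    (fun s hs ↦ (hV s hs.1).mono (Ici_subset_Ici.2 hs.1)) h0
    (fun s _ ↦ (hB s).continuousAt.continuousWithinAt)
    (fun s _ ↦ (hB s).hasDerivWithinAt) (fun s hs ↦ hlt s hs.1) ⟨ht, le_rfl⟩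

theorem hasDerivAt_const_mul_exp_neg (B c t : ℝ) :
    HasDerivAt (fun t ↦ B * Real.exp (-(c * t))) (-c * (B * Real.exp (-(c * t)))) t := by
  exact (((hasDerivAt_id' t).const_mul c).neg.exp.const_mul B).congr_deriv (by
    simp only [Pi.neg_apply]; ring)

theorem tendsto_const_mul_exp_neg (B : ℝ) {c : ℝ} (hc : 0 < c) :
    Tendsto (fun t : ℝ ↦ B * Real.exp (-(c * t))) atTop (𝓝 0) := by
  have h : Tendsto (fun t : ℝ ↦ c * t) atTop atTop := tendsto_id.const_mul_atTop hc
  simpa using (Real.tendsto_exp_neg_atTop_nhds_zero.comp h).const_mul B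

/-- A nonnegative function that is contracted at a linear rate, up to an exponentially decaying
input, tends to zero. -/
theorem tendsto_zero_of_deriv_le {V V' : ℝ → ℝ} {κ C c : ℝ} (hκ : 0 < κ) (hC : 0 ≤ C)
    (hc : 0 < c) (hV : ∀ t, 0 ≤ t → HasDerivWithinAt V (V' t) (Ici 0) t)
    (hnn : ∀ t, 0 ≤ t → 0 ≤ V t)
    (hle : ∀ t, 0 ≤ t → V' t ≤ -κ * V t + C * Real.exp (-(c * t))) :
    Tendsto V atTop (𝓝 0) := by
  -- the fence decays at a rate `b` slower than both the input and the contraction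
  obtain ⟨b, hb, hbc, hbκ⟩ : ∃ b, 0 < b ∧ b ≤ c ∧ b ≤ κ / 2 :=
    ⟨min c (κ / 2), by positivity, min_le_left _ _, min_le_right _ _⟩
  obtain ⟨B, hB0, hBC⟩ : ∃ B, V 0 ≤ B ∧ C < κ / 2 * B := by
    refine ⟨max (V 0) (2 / κ * (C + 1)), le_max_left _ _, ?_⟩
    have h1 : κ / 2 * (2 / κ * (C + 1)) ≤ κ / 2 * max (V 0) (2 / κ * (C + 1)) := by
      gcongr
      exact le_max_right _ _
    have h2 : κ / 2 * (2 / κ * (C + 1)) = C + 1 := by field_simp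
    linarith
  have hBpos : 0 < B := by
    by_contra hneg
    nlinarith
  have key := le_of_deriv_lt_at_contact hV (hasDerivAt_const_mul_exp_neg B b) (by simpa using hB0)
    (fun t ht heq ↦ by
      have h1 := hle t ht
      have h2 : Real.exp (-(c * t)) ≤ Real.exp (-(b * t)) := by
        apply Real.exp_le_exp.2
        nlinarith
      have h3 := Real.exp_pos (-(b * t))
      rw [heq] at h1
      have h4 : C * Real.exp (-(c * t)) ≤ C * Real.exp (-(b * t)) := by gcongr
      have h5 : C * Real.exp (-(b * t)) < κ / 2 * B * Real.exp (-(b * t)) := by gcongr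
      have h6 : b * (B * Real.exp (-(b * t))) ≤ κ / 2 * (B * Real.exp (-(b * t))) := by gcongr
      linarith)
  refine tendsto_of_tendsto_of_tendsto_of_le_of_le' tendsto_const_nhds
    (tendsto_const_mul_exp_neg B hb) ?_ ?_
  · filter_upwards [eventually_ge_atTop 0] with t ht using hnn t ht
  · filter_upwards [eventually_ge_atTop 0] with t ht using key t ht

/-! ### The double integrator under saturated control -/

theorem sat_eq_max_min {U : ℝ} (hU : 0 < U) (s : ℝ) : sat U s = max (-U) (min s U) := by
  unfold sat
  rcases lt_trichotomy s 0 with h | rfl | h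
  · rw [Real.sign_of_neg h, abs_of_neg h, min_eq_left (a := s) (by linarith), neg_one_mul,
      ← max_neg_neg, neg_neg, max_comm]
  · simp [hU.le]
  · rw [Real.sign_of_pos h, abs_of_pos h, one_mul, max_eq_right]
    exact le_min (by linarith) (by linarith)

theorem lipschitzWith_sat {U : ℝ} (hU : 0 < U) : LipschitzWith 1 (sat U) := by
  rw [show sat U = fun s ↦ max (-U) (min s U) from funext (sat_eq_max_min hU)]
  exact (LipschitzWith.id.min_const U).const_max (-U)

/-- The primitive of the saturation: `s ^ 2 / 2` for `|s| ≤ U` and `U * |s| - U ^ 2 / 2` beyond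
(the Huber function), written as one formula in terms of `sat`. -/
noncomputable def satPrimitive (U s : ℝ) : ℝ := s * sat U s - sat U s ^ 2 / 2

theorem abs_satPrimitive_sub_le {U : ℝ} (hU : 0 < U) (s t : ℝ) :
    |satPrimitive U t - satPrimitive U s - (t - s) * sat U s| ≤ (t - s) ^ 2 := by
  simp only [satPrimitive, sat_eq_max_min hU, abs_le]
  rcases max_cases (-U) (min s U) with ⟨h1, h1'⟩ | ⟨h1, h1'⟩ <;>
  rcases max_cases (-U) (min t U) with ⟨h2, h2'⟩ | ⟨h2, h2'⟩ <;>
  rcases min_cases s U with ⟨h3, h3'⟩ | ⟨h3, h3'⟩ <;>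
  rcases min_cases t U with ⟨h4, h4'⟩ | ⟨h4, h4'⟩ <;>
  rw [h1, h2] <;> simp only [h3, h4] at * <;>
  constructor <;> nlinarith

theorem hasDerivAt_satPrimitive {U : ℝ} (hU : 0 < U) (s : ℝ) :
    HasDerivAt (satPrimitive U) (sat U s) s := by
  rw [hasDerivAt_iff_isLittleO]
  refine (Asymptotics.IsBigO.of_bound 1 (Eventually.of_forall fun t ↦ ?_)).trans_isLittleO
    (g := fun t ↦ (t - s) ^ 2) ?_
  · simpa using abs_satPrimitive_sub_le hU s t
  · simpa using Asymptotics.isLittleO_pow_sub_sub s (one_lt_two)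

theorem abs_sat_le_bound {U : ℝ} (hU : 0 < U) (s : ℝ) : |sat U s| ≤ U := by
  rw [sat_eq_max_min hU, abs_le]
  exact ⟨le_max_left _ _, max_le (by linarith) (min_le_right _ _)⟩

theorem sat_sq_le {U : ℝ} (hU : 0 < U) (s : ℝ) : sat U s ^ 2 ≤ s * sat U s := by
  rw [sat_eq_max_min hU]
  rcases max_cases (-U) (min s U) with ⟨h1, h1'⟩ | ⟨h1, h1'⟩ <;>
  rcases min_cases s U with ⟨h3, h3'⟩ | ⟨h3, h3'⟩ <;>
  rw [h1] <;> simp only [h3] at * <;> nlinarith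

theorem mul_sat_le_sq {U : ℝ} (hU : 0 < U) (s : ℝ) : s * sat U s ≤ s ^ 2 := by
  rw [sat_eq_max_min hU]
  rcases max_cases (-U) (min s U) with ⟨h1, h1'⟩ | ⟨h1, h1'⟩ <;>
  rcases min_cases s U with ⟨h3, h3'⟩ | ⟨h3, h3'⟩ <;>
  rw [h1] <;> simp only [h3] at * <;> nlinarith

theorem mul_abs_le_satPrimitive {U : ℝ} (hU : 0 < U) (s : ℝ) :
    U * |s| - U ^ 2 / 2 ≤ satPrimitive U s := by
  rw [satPrimitive, sat_eq_max_min hU]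
  rcases max_cases (-U) (min s U) with ⟨h1, h1'⟩ | ⟨h1, h1'⟩ <;>
  rcases min_cases s U with ⟨h3, h3'⟩ | ⟨h3, h3'⟩ <;>
  rcases abs_cases s with ⟨h5, h5'⟩ | ⟨h5, h5'⟩ <;>
  rw [h1, h5] <;> simp only [h3] at * <;> nlinarith [sq_nonneg (s - U), sq_nonneg (s + U)]

/-- On a bounded interval the saturation dominates a linear function. -/
theorem mul_sq_le_mul_sat {U S : ℝ} (hU : 0 < U) (hUS : U ≤ S) {s : ℝ} (hs : |s| ≤ S) :
    U / S * s ^ 2 ≤ s * sat U s := by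
  have hS : 0 < S := by linarith
  rw [div_mul_eq_mul_div, div_le_iff₀ hS, sat_eq_max_min hU]
  have := abs_le.1 hs
  rcases max_cases (-U) (min s U) with ⟨h1, h1'⟩ | ⟨h1, h1'⟩ <;>
  rcases min_cases s U with ⟨h3, h3'⟩ | ⟨h3, h3'⟩ <;>
  rw [h1] <;> simp only [h3] at *
  · have : 0 ≤ (-s) * U * (S + s) := by
      apply mul_nonneg (mul_nonneg _ hU.le) <;> linarith
    linarith
  · linarith
  · nlinarith [sq_nonneg s]
  · have : 0 ≤ s * U * (S - s) := by
      apply mul_nonneg (mul_nonneg _ hU.le) <;> linarith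
    linarith

/-- Energy bound. In the coordinates `s = p + q` and `q`, the energy
`satPrimitive U s + q ^ 2 / 2` of the double integrator grows at most at a rate proportional to
the integrable disturbance times the energy itself, so it stays bounded. -/
theorem exists_energy_bound {U D c : ℝ} (hU : 0 < U) (hc : 0 < c) {s q d : ℝ → ℝ}
    (hs : ∀ t, 0 ≤ t → HasDerivWithinAt s (q t - sat U (s t) - d t) (Ici 0) t)
    (hq : ∀ t, 0 ≤ t → HasDerivWithinAt q (-sat U (s t) - d t) (Ici 0) t)
    (hd : ∀ t, 0 ≤ t → |d t| ≤ D * Real.exp (-(c * t))) :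
    ∃ B, ∀ t, 0 ≤ t → satPrimitive U (s t) + q t ^ 2 / 2 ≤ B := by
  have hD : 0 ≤ D := by simpa using (abs_nonneg _).trans (hd 0 le_rfl)
  set a := U + 1 + U ^ 2 with ha
  have hV : ∀ t, 0 ≤ t → HasDerivWithinAt (fun t ↦ satPrimitive U (s t) + q t ^ 2 / 2 + a)
      (sat U (s t) * (q t - sat U (s t) - d t) + q t * (-sat U (s t) - d t)) (Ici 0) t := by
    intro t ht
    have h := (((hasDerivAt_satPrimitive hU (s t)).comp_hasDerivWithinAt t (hs t ht)).add
      (((hq t ht).pow 2).div_const 2)).add_const a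
    refine h.congr_deriv ?_
    push_cast
    ring
  -- The fence is increasing and bounded; its logarithmic derivative `2 * (D + 1) * exp (-(c * t))`
  -- exceeds the bound on the disturbance.
  set E₀ := satPrimitive U (s 0) + q 0 ^ 2 / 2 + a with hE₀
  have hpos : ∀ t, U + 1 + q t ^ 2 / 2 ≤ satPrimitive U (s t) + q t ^ 2 / 2 + a := by
    intro t
    have := mul_abs_le_satPrimitive hU (s t)
    nlinarith [mul_nonneg hU.le (abs_nonneg (s t)), sq_nonneg U]
  have hE₀pos : 0 < E₀ := by have := hpos 0; nlinarith [sq_nonneg (q 0)]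
  set k := 2 * (D + 1) / c with hk
  have hB : ∀ t, HasDerivAt (fun t ↦ E₀ * Real.exp k * Real.exp (-(k * Real.exp (-(c * t)))))
      (E₀ * Real.exp k * (Real.exp (-(k * Real.exp (-(c * t)))) *
        (-(-c * (k * Real.exp (-(c * t))))))) t := fun t ↦
    ((hasDerivAt_const_mul_exp_neg k c t).neg.exp).const_mul _
  have hkpos : 0 < k := by positivity
  have key := le_of_deriv_lt_at_contact hV hB
    (by simp [mul_assoc, ← Real.exp_add, hE₀]) (fun t ht heq ↦ by
      set e := Real.exp (-(c * t))
      have he : 0 < e := Real.exp_pos _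
      have h1 := hd t ht
      have h2 := hpos t
      have h3 : |sat U (s t)| ≤ U := abs_sat_le_bound hU _
      set W := satPrimitive U (s t) + q t ^ 2 / 2 + a with hW
      have h4 : |q t| ≤ 1 + q t ^ 2 / 2 := by
        nlinarith [sq_nonneg (|q t| - 1), sq_abs (q t)]
      have h5 : sat U (s t) * (q t - sat U (s t) - d t) + q t * (-sat U (s t) - d t)
          ≤ W * (D * e) := by
        have h6 : -((sat U (s t) + q t) * d t) ≤ (|sat U (s t)| + |q t|) * |d t| := by
          rw [neg_mul_eq_mul_neg]
          refine (le_abs_self _).trans ?_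
          rw [abs_mul, abs_neg]
          gcongr
          exact abs_add_le _ _
        have h7 : (|sat U (s t)| + |q t|) * |d t| ≤ W * (D * e) := by
          have hW0 : 0 ≤ W := by nlinarith [sq_nonneg (q t)]
          gcongr
          linarith
        nlinarith [sq_nonneg (sat U (s t))]
      have h8 : E₀ * Real.exp k * (Real.exp (-(k * e)) * (-(-c * (k * e))))
          = W * (2 * (D + 1) * e) := by
        rw [heq, hk]
        field_simp
      rw [h8]
      refine h5.trans_lt ?_
      have hWpos : 0 < W := by nlinarith [sq_nonneg (q t)]
      gcongr
      linarith)
  refine ⟨E₀ * Real.exp k, fun t ht ↦ ?_⟩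
  have h1 := key t ht
  have h2 : Real.exp (-(k * Real.exp (-(c * t)))) ≤ 1 := by
    rw [Real.exp_le_one_iff]
    have := Real.exp_pos (-(c * t))
    nlinarith
  have h3 : E₀ * Real.exp k * Real.exp (-(k * Real.exp (-(c * t)))) ≤ E₀ * Real.exp k * 1 := by
    gcongr
  have h4 : 0 < a := by positivity
  linarith

/-- The double integrator under the saturated control `-sat U (p + q)` and an exponentially
decaying disturbance converges to the origin. Once the state is known to be bounded, the
saturation acts like a linear feedback, and the energy plus a small cross term is a strict
Lyapunov function. -/
theorem tendsto_zero_of_saturated_double_integrator {U D c : ℝ} (hU : 0 < U) (hc : 0 < c)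
    {p q d : ℝ → ℝ}
    (hp : ∀ t, 0 ≤ t → HasDerivWithinAt p (q t) (Ici 0) t)
    (hq : ∀ t, 0 ≤ t → HasDerivWithinAt q (-sat U (p t + q t) - d t) (Ici 0) t)
    (hd : ∀ t, 0 ≤ t → |d t| ≤ D * Real.exp (-(c * t))) :
    Tendsto p atTop (𝓝 0) := by
  have hD : 0 ≤ D := by simpa using (abs_nonneg _).trans (hd 0 le_rfl)
  set s : ℝ → ℝ := fun t ↦ p t + q t with hs_def
  have hs : ∀ t, 0 ≤ t → HasDerivWithinAt s (q t - sat U (s t) - d t) (Ici 0) t := by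
    intro t ht
    refine ((hp t ht).add (hq t ht)).congr_deriv ?_
    ring
  obtain ⟨B, hB⟩ := exists_energy_bound hU hc hs hq hd
  obtain ⟨S, hUS, hS⟩ : ∃ S, U ≤ S ∧ ∀ t, 0 ≤ t → |s t| ≤ S := by
    refine ⟨max U ((B + U ^ 2 / 2) / U), le_max_left _ _, fun t ht ↦ le_max_of_le_right ?_⟩
    rw [le_div_iff₀ hU]
    nlinarith [hB t ht, mul_abs_le_satPrimitive hU (s t), sq_nonneg (q t)]
  obtain ⟨Q, hQ0, hQ⟩ : ∃ Q, 0 ≤ Q ∧ ∀ t, 0 ≤ t → |q t| ≤ Q := by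
    refine ⟨1 + B + U ^ 2, ?_, fun t ht ↦ ?_⟩
    · nlinarith [hB 0 le_rfl, mul_abs_le_satPrimitive hU (s 0), sq_nonneg (q 0),
        mul_nonneg hU.le (abs_nonneg (s 0))]
    · nlinarith [hB t ht, mul_abs_le_satPrimitive hU (s t), sq_nonneg (|q t| - 1), sq_abs (q t),
        mul_nonneg hU.le (abs_nonneg (s t))]
  have hSpos : 0 < S := by linarith
  set k := U / S with hk
  have hk0 : 0 < k := by positivity
  have hk1 : k ≤ 1 := (div_le_one hSpos).2 hUS
  set ε := k ^ 2 / 4 with hε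
  have hε0 : 0 < ε := by positivity
  have hεk : ε ≤ k / 4 := by nlinarith
  have hVd : ∀ t, 0 ≤ t → HasDerivWithinAt
      (fun t ↦ satPrimitive U (s t) + q t ^ 2 / 2 - ε * (s t * q t))
      (sat U (s t) * (q t - sat U (s t) - d t) + q t * (-sat U (s t) - d t)
        - ε * ((q t - sat U (s t) - d t) * q t + s t * (-sat U (s t) - d t))) (Ici 0) t := by
    intro t ht
    have h := (((hasDerivAt_satPrimitive hU (s t)).comp_hasDerivWithinAt t (hs t ht)).add
      (((hq t ht).pow 2).div_const 2)).sub (((hs t ht).mul (hq t ht)).const_mul ε)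
    refine h.congr_deriv ?_
    push_cast
    ring
  have hlow : ∀ t, 0 ≤ t → k / 4 * (s t ^ 2 + q t ^ 2) ≤
      satPrimitive U (s t) + q t ^ 2 / 2 - ε * (s t * q t) := by
    intro t ht
    have h1 := mul_sq_le_mul_sat hU hUS (hS t ht)
    have h2 := sat_sq_le hU (s t)
    have h3 : ε * (s t * q t) ≤ k / 4 * ((s t ^ 2 + q t ^ 2) / 2) := by
      have h4 : s t * q t ≤ (s t ^ 2 + q t ^ 2) / 2 := by nlinarith [sq_nonneg (s t - q t)]
      calc ε * (s t * q t) ≤ ε * ((s t ^ 2 + q t ^ 2) / 2) := by gcongr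
        _ ≤ _ := by gcongr
    simp only [satPrimitive]
    nlinarith [sq_nonneg (s t), sq_nonneg (q t)]
  have hup : ∀ t, satPrimitive U (s t) + q t ^ 2 / 2 - ε * (s t * q t) ≤
      2 * (s t ^ 2 + q t ^ 2) := by
    intro t
    have h1 := mul_sat_le_sq hU (s t)
    have h3 : -(ε * (s t * q t)) ≤ 1 * ((s t ^ 2 + q t ^ 2) / 2) := by
      have h4 : -(s t * q t) ≤ (s t ^ 2 + q t ^ 2) / 2 := by nlinarith [sq_nonneg (s t + q t)]
      calc -(ε * (s t * q t)) = ε * (-(s t * q t)) := by ring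
        _ ≤ ε * ((s t ^ 2 + q t ^ 2) / 2) := by gcongr
        _ ≤ _ := by gcongr; linarith
    simp only [satPrimitive]
    nlinarith [sq_nonneg (s t), sq_nonneg (q t), sq_nonneg (sat U (s t))]
  have hVlim := tendsto_zero_of_deriv_le (κ := ε / 4) (C := (U + Q + ε * Q + ε * S) * D)
    (by positivity) (by positivity) hc hVd
    (fun t ht ↦ (by positivity : 0 ≤ k / 4 * (s t ^ 2 + q t ^ 2)).trans (hlow t ht))
    (fun t ht ↦ by
      have h1 := mul_sq_le_mul_sat hU hUS (hS t ht)
      have h2 := sat_sq_le hU (s t)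
      have h3 := mul_sat_le_sq hU (s t)
      have h4 := hup t
      have h5 := hd t ht
      set e := Real.exp (-(c * t))
      set r := sat U (s t) with hr
      -- `k |s| ≤ |r|`, in squared form
      have h6 : k ^ 2 * s t ^ 2 ≤ r ^ 2 := by
        rcases eq_or_ne (s t) 0 with h0 | h0
        · rw [h0]; nlinarith [sq_nonneg r]
        · have h7 : 0 < s t ^ 2 := by positivity
          have h8 : (k * s t ^ 2) ^ 2 ≤ (s t * r) ^ 2 := by gcongr
          have h9 : s t ^ 2 * (k ^ 2 * s t ^ 2) ≤ s t ^ 2 * r ^ 2 := by nlinarith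
          exact le_of_mul_le_mul_left h9 h7
      have h7 : -(r * d t) - q t * d t + ε * (q t * d t) + ε * (s t * d t) ≤
          (U + Q + ε * Q + ε * S) * (D * e) := by
        have hr' : |r| ≤ U := abs_sat_le_bound hU _
        have b1 : -(r * d t) ≤ |r| * |d t| := by rw [← abs_mul]; exact neg_le_abs _
        have b2 : -(q t * d t) ≤ |q t| * |d t| := by rw [← abs_mul]; exact neg_le_abs _
        have b3 : q t * d t ≤ |q t| * |d t| := by rw [← abs_mul]; exact le_abs_self _
        have b4 : s t * d t ≤ |s t| * |d t| := by rw [← abs_mul]; exact le_abs_self _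
        have hQt := hQ t ht
        have hSt := hS t ht
        calc _ ≤ |r| * |d t| + |q t| * |d t| + ε * (|q t| * |d t|) + ε * (|s t| * |d t|) := by
              have b5 : ε * (q t * d t) ≤ ε * (|q t| * |d t|) := by gcongr
              have b6 : ε * (s t * d t) ≤ ε * (|s t| * |d t|) := by gcongr
              linarith
          _ = (|r| + |q t| + ε * |q t| + ε * |s t|) * |d t| := by ring
          _ ≤ _ := by gcongr
      have h8 : ε * (r * q t) ≤ ε * ((r ^ 2 + q t ^ 2) / 2) := by
        gcongr; nlinarith [sq_nonneg (r - q t)]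
      have h9 : ε * (s t * r) ≤ ε * s t ^ 2 := by gcongr
      have h10 : ε * r ^ 2 ≤ r ^ 2 / 4 := by nlinarith [sq_nonneg r]
      have h11 : ε / 4 * (satPrimitive U (s t) + q t ^ 2 / 2 - ε * (s t * q t)) ≤
          ε / 4 * (2 * (s t ^ 2 + q t ^ 2)) := by gcongr
      have h12 : ε * s t ^ 2 ≤ r ^ 2 / 4 := by rw [hε]; linarith
      linarith [sq_nonneg r])
  have hsq : Tendsto (fun t ↦ s t ^ 2 + q t ^ 2) atTop (𝓝 0) := by
    have h := hVlim.const_mul (4 / k)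
    rw [mul_zero] at h
    refine squeeze_zero' (Eventually.of_forall fun t ↦ by positivity) ?_ h
    filter_upwards [eventually_ge_atTop 0] with t ht
    have h1 : s t ^ 2 + q t ^ 2 = 4 / k * (k / 4 * (s t ^ 2 + q t ^ 2)) := by field_simp
    rw [h1]
    have := hlow t ht
    gcongr
  have hp2 : Tendsto (fun t ↦ p t ^ 2) atTop (𝓝 0) := by
    have h := hsq.const_mul 2
    rw [mul_zero] at h
    refine squeeze_zero (fun t ↦ by positivity) (fun t ↦ ?_) h
    simp only [hs_def]
    nlinarith [sq_nonneg (p t + 2 * q t)]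
  have := hp2.sqrt
  simp only [Real.sqrt_sq_eq_abs, Real.sqrt_zero] at this
  exact (tendsto_zero_iff_abs_tendsto_zero _).2 this

/-! ### Strongly monotone pseudo-gradients and Nash equilibria -/

variable {N : ℕ} {f : Fin N → (Fin N → ℝ) → ℝ}

theorem hasDerivAt_comp_update (hf : ∀ i, ContDiff ℝ 2 (f i)) (i : Fin N) (x : Fin N → ℝ) (s : ℝ) :
    HasDerivAt (fun s ↦ f i (Function.update x i s))
      (fderiv ℝ (f i) (Function.update x i s) (Pi.single i 1)) s :=
  (((hf i).differentiable two_ne_zero) _).hasFDerivAt.comp_hasDerivAt s (hasDerivAt_update x i s)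

theorem ownPartial_eq_fderiv (hf : ∀ i, ContDiff ℝ 2 (f i)) (i : Fin N) (x : Fin N → ℝ) :
    ownPartial f i x = fderiv ℝ (f i) x (Pi.single i 1) := by
  rw [ownPartial, (hasDerivAt_comp_update hf i x (x i)).deriv, Function.update_eq_self]

theorem hasDerivAt_ownPartial (hf : ∀ i, ContDiff ℝ 2 (f i)) (i : Fin N) (x : Fin N → ℝ) (s : ℝ) :
    HasDerivAt (fun s ↦ f i (Function.update x i s)) (ownPartial f i (Function.update x i s)) s := by
  rw [ownPartial_eq_fderiv hf]
  exact hasDerivAt_comp_update hf i x s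

theorem contDiff_ownPartial (hf : ∀ i, ContDiff ℝ 2 (f i)) (i : Fin N) :
    ContDiff ℝ 1 (ownPartial f i) := by
  rw [funext (ownPartial_eq_fderiv hf i)]
  exact ((hf i).fderiv_right (m := 1) (by norm_num)).clm_apply contDiff_const

theorem ownPartial_eq_zero_of_isNashEquilibrium {x : Fin N → ℝ} (hx : IsNashEquilibrium f x)
    (i : Fin N) : ownPartial f i x = 0 := by
  refine IsLocalMin.deriv_eq_zero (Eventually.of_forall fun s ↦ ?_)
  simpa using hx i s

/-- Strong monotonicity, restricted to variations of one coordinate, makes each cost convex in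
the player's own action; hence a zero of the pseudo-gradient is a Nash equilibrium. -/
theorem isNashEquilibrium_of_ownPartial_eq_zero (hf : ∀ i, ContDiff ℝ 2 (f i)) {m : ℝ}
    (hm : 0 < m) (hmono : StronglyMonotoneWith f m) {x : Fin N → ℝ}
    (hx : ∀ i, ownPartial f i x = 0) : IsNashEquilibrium f x := by
  intro i s
  have hd := hasDerivAt_ownPartial hf i x
  have hderiv : deriv (fun s ↦ f i (Function.update x i s)) =
      fun s ↦ ownPartial f i (Function.update x i s) := funext fun s ↦ (hd s).deriv
  have hmon : Monotone (deriv (fun s ↦ f i (Function.update x i s))) := by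
    rw [hderiv]
    intro a b hab
    have h := hmono (Function.update x i b) (Function.update x i a)
    have hne : ∀ j ∈ Finset.univ, j ≠ i →
        Function.update x i b j - Function.update x i a j = 0 := by
      intro j _ hj
      simp [hj]
    rw [Finset.sum_eq_single i (fun j hj hji ↦ by rw [hne j hj hji]; ring) (by simp),
      Finset.sum_eq_single i (fun j hj hji ↦ by rw [hne j hj hji]; ring) (by simp)] at h
    simp only [Function.update_self] at h
    rcases hab.eq_or_lt with rfl | hlt
    · exact le_rfl
    · have h1 : 0 < b - a := sub_pos.2 hlt
      have h2 : 0 ≤ (b - a) * (ownPartial f i (Function.update x i b) -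
        ownPartial f i (Function.update x i a)) := le_trans (by positivity) h
      exact sub_nonneg.1 (nonneg_of_mul_nonneg_right h2 h1)
  have hconv := hmon.convexOn_univ_of_deriv (fun s ↦ (hd s).differentiableAt)
  have hmin := hconv.isMinOn_of_rightDeriv_eq_zero (x := x i) (by simp) (by
    rw [(hd (x i)).hasDerivWithinAt.derivWithin (uniqueDiffWithinAt_Ioi _)]
    simpa using hx i)
  simpa using hmin (mem_univ s)

theorem eq_of_ownPartial_eq_zero {m : ℝ} (hm : 0 < m) (hmono : StronglyMonotoneWith f m)
    {x z : Fin N → ℝ} (hx : ∀ i, ownPartial f i x = 0) (hz : ∀ i, ownPartial f i z = 0) :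
    x = z := by
  have h := hmono x z
  simp only [hx, hz, sub_self, mul_zero, Finset.sum_const_zero] at h
  have h1 : ∑ i, (x i - z i) ^ 2 = 0 :=
    le_antisymm (by nlinarith) (Finset.sum_nonneg fun i _ ↦ sq_nonneg _)
  rw [Finset.sum_eq_zero_iff_of_nonneg fun i _ ↦ sq_nonneg _] at h1
  ext i
  have := h1 i (Finset.mem_univ i)
  nlinarith [pow_eq_zero_iff (two_ne_zero) |>.1 this]

theorem sq_norm_le_sum_sq {ι : Type*} [Fintype ι] (v : ι → ℝ) : ‖v‖ ^ 2 ≤ ∑ i, v i ^ 2 := by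
  have hs : 0 ≤ ∑ i, v i ^ 2 := Finset.sum_nonneg fun i _ ↦ sq_nonneg _
  rw [← Real.le_sqrt (norm_nonneg _) hs, pi_norm_le_iff_of_nonneg (Real.sqrt_nonneg _)]
  intro i
  rw [Real.norm_eq_abs]
  exact Real.abs_le_sqrt (Finset.single_le_sum (f := fun i ↦ v i ^ 2) (fun i _ ↦ sq_nonneg _)
    (Finset.mem_univ i))

/-- The squared length of a strongly monotone continuous pseudo-gradient attains its minimum. -/
theorem exists_forall_sum_sq_ownPartial_le (hf : ∀ i, ContDiff ℝ 2 (f i)) {m : ℝ}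
    (hm : 0 < m) (hmono : StronglyMonotoneWith f m) :
    ∃ x, ∀ y, ∑ i, ownPartial f i x ^ 2 ≤ ∑ i, ownPartial f i y ^ 2 := by
  have hc : Continuous fun x ↦ ∑ i, ownPartial f i x ^ 2 :=
    continuous_finsetSum _ fun i _ ↦ (contDiff_ownPartial hf i).continuous.pow 2
  refine hc.exists_forall_le_of_isBounded 0 ?_
  set c := ∑ i, ownPartial f i 0 ^ 2 with hc_def
  refine (Metric.isBounded_closedBall (x := (0 : Fin N → ℝ)) (r := √(4 * c / m ^ 2))).subset ?_
  intro x hx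
  simp only [mem_ofPred_eq] at hx
  rw [mem_closedBall_zero_iff]
  apply Real.le_sqrt_of_sq_le
  refine (sq_norm_le_sum_sq x).trans ?_
  rw [le_div_iff₀ (by positivity)]
  have h := hmono x 0
  simp only [Pi.zero_apply, sub_zero] at h
  have h2 : ∑ i, x i * (ownPartial f i x - ownPartial f i 0) ≤
      m / 2 * ∑ i, x i ^ 2 + 1 / m * (∑ i, ownPartial f i x ^ 2 + c) := by
    rw [hc_def, ← Finset.sum_add_distrib, Finset.mul_sum, Finset.mul_sum,
      ← Finset.sum_add_distrib]
    refine Finset.sum_le_sum fun i _ ↦ ?_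
    have h3 : 0 ≤ (m * x i - (ownPartial f i x - ownPartial f i 0)) ^ 2 +
      (ownPartial f i x + ownPartial f i 0) ^ 2 := by positivity
    rw [div_mul_eq_mul_div, div_mul_eq_mul_div, div_add_div _ _ two_ne_zero hm.ne',
      le_div_iff₀ (by positivity)]
    nlinarith
  have h4 : 1 / m * (∑ i, ownPartial f i x ^ 2 + c) ≤ 1 / m * (2 * c) := by
    gcongr
    linarith
  have h5 : 1 / m * (2 * c) * m = 2 * c := by field_simp
  nlinarith

/-- A strongly monotone pseudo-gradient `P` has a zero: at a minimum `x` of `|P| ^ 2`, the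
derivative of `|P| ^ 2` in the direction `w = P x` vanishes, while strong monotonicity bounds it
below by `2 * m * |w| ^ 2`. -/
theorem exists_ownPartial_eq_zero (hf : ∀ i, ContDiff ℝ 2 (f i)) {m : ℝ} (hm : 0 < m)
    (hmono : StronglyMonotoneWith f m) : ∃ x, ∀ i, ownPartial f i x = 0 := by
  obtain ⟨x, hx⟩ := exists_forall_sum_sq_ownPartial_le hf hm hmono
  refine ⟨x, ?_⟩
  set w : Fin N → ℝ := fun i ↦ ownPartial f i x with hw
  have hline : ∀ t : ℝ, HasDerivAt (fun t : ℝ ↦ x + t • w) w t := fun t ↦ by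
    simpa using ((hasDerivAt_id t).smul_const w).const_add x
  have hP : ∀ i, HasDerivAt (fun t : ℝ ↦ ownPartial f i (x + t • w))
      (fderiv ℝ (ownPartial f i) x w) 0 := fun i ↦ by
    have h := ((contDiff_ownPartial hf i).differentiable one_ne_zero x).hasFDerivAt
    exact h.comp_hasDerivAt_of_eq (0 : ℝ) (hline 0) (by simp)
  have hcrit : ∑ i, w i * fderiv ℝ (ownPartial f i) x w = 0 := by
    have h1 : HasDerivAt (fun t : ℝ ↦ ∑ i, ownPartial f i (x + t • w) ^ 2)
        (∑ i, 2 * (w i * fderiv ℝ (ownPartial f i) x w)) 0 := by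
      refine (HasDerivAt.fun_sum fun i (_ : i ∈ Finset.univ) ↦ (hP i).pow 2).congr_deriv ?_
      refine Finset.sum_congr rfl fun i _ ↦ ?_
      simp [hw]
      ring
    have h2 : IsLocalMin (fun t : ℝ ↦ ∑ i, ownPartial f i (x + t • w) ^ 2) 0 :=
      Eventually.of_forall fun t ↦ by simpa using hx (x + t • w)
    have h3 := h2.hasDerivAt_eq_zero h1
    rw [← Finset.mul_sum] at h3
    linarith
  have hmon : Monotone fun t : ℝ ↦
      ∑ i, w i * ownPartial f i (x + t • w) - t * (m * ∑ i, w i ^ 2) := by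
    intro a b hab
    rcases hab.eq_or_lt with rfl | hlt
    · exact le_rfl
    have hpos : 0 < b - a := sub_pos.2 hlt
    have h := hmono (x + b • w) (x + a • w)
    have e1 : ∀ i, (x + b • w) i - (x + a • w) i = (b - a) * w i := fun i ↦ by
      simp only [Pi.add_apply, Pi.smul_apply, smul_eq_mul]; ring
    simp only [e1, mul_pow, ← Finset.mul_sum, mul_assoc] at h
    have h2 : (b - a) * ((b - a) * (m * ∑ i, w i ^ 2)) ≤ (b - a) *
        (∑ i, w i * ownPartial f i (x + b • w) - ∑ i, w i * ownPartial f i (x + a • w)) := by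
      rw [← Finset.sum_sub_distrib]
      simp only [← mul_sub]
      nlinarith
    have h3 := le_of_mul_le_mul_left h2 hpos
    simp only
    linarith
  have hderiv : HasDerivAt
      (fun t : ℝ ↦ ∑ i, w i * ownPartial f i (x + t • w) - t * (m * ∑ i, w i ^ 2))
      (∑ i, w i * fderiv ℝ (ownPartial f i) x w - 1 * (m * ∑ i, w i ^ 2)) 0 :=
    (HasDerivAt.fun_sum fun i (_ : i ∈ Finset.univ) ↦ (hP i).const_mul (w i)).sub
      ((hasDerivAt_id' (0 : ℝ)).mul_const _)
  have hnn := hmon.deriv_nonneg (x := 0)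
  rw [hderiv.deriv, hcrit] at hnn
  have h1 : ∑ i, w i ^ 2 = 0 :=
    le_antisymm (by nlinarith) (Finset.sum_nonneg fun i _ ↦ sq_nonneg _)
  rw [Finset.sum_eq_zero_iff_of_nonneg fun i _ ↦ sq_nonneg _] at h1
  exact fun i ↦ pow_eq_zero_iff two_ne_zero |>.1 (h1 i (Finset.mem_univ i))

/-- A common Lipschitz constant and derivative bound for the partial derivatives on a ball of the
sup norm. -/
theorem exists_lipschitz_ownPartial (hf : ∀ i, ContDiff ℝ 2 (f i)) (xs : Fin N → ℝ) (r : ℝ) :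
    ∃ l : ℝ≥0, ∀ i, LipschitzOnWith l (ownPartial f i) (Metric.closedBall xs r) ∧
      ∀ y ∈ Metric.closedBall xs r, ‖fderiv ℝ (ownPartial f i) y‖ ≤ l := by
  have hb : ∀ i, ∃ l : ℝ, ∀ y ∈ Metric.closedBall xs r, ‖fderiv ℝ (ownPartial f i) y‖ ≤ l :=
    fun i ↦ (isCompact_closedBall xs r).exists_bound_of_continuousOn
      ((contDiff_ownPartial hf i).continuous_fderiv one_ne_zero).continuousOn
  choose l hl using hb
  have hl' : ∀ i, ∀ y ∈ Metric.closedBall xs r, ‖fderiv ℝ (ownPartial f i) y‖ ≤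
      (∑ i, (l i).toNNReal : ℝ≥0) := by
    intro i y hy
    refine (hl i y hy).trans ((Real.le_coe_toNNReal _).trans ?_)
    exact_mod_cast Finset.single_le_sum (f := fun i ↦ (l i).toNNReal) (fun _ _ ↦ zero_le)
      (Finset.mem_univ i)
  refine ⟨∑ i, (l i).toNNReal, fun i ↦ ⟨?_, hl' i⟩⟩
  exact (convex_closedBall xs r).lipschitzOnWith_of_nnnorm_fderiv_le
    (fun y _ ↦ (contDiff_ownPartial hf i).differentiable one_ne_zero y) (fun y hy ↦ hl' i y hy)

/-! ### Coercivity of the grounded Laplacians -/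

/-- A continuous function that is homogeneous of degree two and positive away from the origin
dominates a multiple of the squared norm. -/
theorem exists_mul_sq_norm_le {E : Type*} [NormedAddCommGroup E] [NormedSpace ℝ E]
    [FiniteDimensional ℝ E] {Q : E → ℝ} (hQ : Continuous Q)
    (hhom : ∀ (c : ℝ) v, Q (c • v) = c ^ 2 * Q v) (hpos : ∀ v, v ≠ 0 → 0 < Q v) :
    ∃ c, 0 < c ∧ ∀ v, c * ‖v‖ ^ 2 ≤ Q v := by
  have := FiniteDimensional.proper_real E
  obtain ⟨c, hc, hcQ⟩ := (isCompact_sphere (0 : E) 1).exists_forall_le' hQ.continuousOn (a := 0)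
    (fun v hv ↦ hpos v (by rintro rfl; simp at hv))
  refine ⟨c, hc, fun v ↦ ?_⟩
  rcases eq_or_ne v 0 with rfl | hv
  · have := hhom 0 0
    simp_all
  have hn : 0 < ‖v‖ := norm_pos_iff.2 hv
  have h := hcQ (‖v‖⁻¹ • v) (by simp [norm_smul, hn.ne'])
  rw [hhom, inv_pow, inv_mul_eq_div, le_div_iff₀ (by positivity)] at h
  exact h

variable {G : SimpleGraph (Fin N)} {A : Matrix (Fin N) (Fin N) ℝ}

/-- Column `j` of the estimation dynamics is driven by the graph Laplacian grounded at the
neighbours of `j`; its quadratic form is a sum of squares. -/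
theorem IsAdjacencyMatrix.sum_mul_eq (hA : IsAdjacencyMatrix G A) (j : Fin N) (v : Fin N → ℝ) :
    ∑ i, v i * (∑ k, A i k * (v i - v k) + A i j * v i) =
      (∑ i, ∑ k, A i k * (v i - v k) ^ 2) / 2 + ∑ i, A i j * v i ^ 2 := by
  have h1 : ∑ i, ∑ k, A i k * (v i - v k) * v i = -∑ i, ∑ k, A i k * (v i - v k) * v k := by
    rw [Finset.sum_comm, ← Finset.sum_neg_distrib]
    refine Finset.sum_congr rfl fun i _ ↦ ?_
    rw [← Finset.sum_neg_distrib]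
    refine Finset.sum_congr rfl fun k _ ↦ ?_
    rw [hA.symm k i]
    ring
  have h2 : ∑ i, ∑ k, A i k * (v i - v k) ^ 2 =
      ∑ i, ∑ k, A i k * (v i - v k) * v i - ∑ i, ∑ k, A i k * (v i - v k) * v k := by
    simp only [← Finset.sum_sub_distrib]
    exact Finset.sum_congr rfl fun i _ ↦ Finset.sum_congr rfl fun k _ ↦ by ring
  have h3 : ∑ i, v i * (∑ k, A i k * (v i - v k) + A i j * v i) =
      ∑ i, ∑ k, A i k * (v i - v k) * v i + ∑ i, A i j * v i ^ 2 := by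
    rw [← Finset.sum_add_distrib]
    refine Finset.sum_congr rfl fun i _ ↦ ?_
    rw [← Finset.sum_mul]
    ring
  rw [h3, h2]
  linarith

theorem IsAdjacencyMatrix.nonneg (hA : IsAdjacencyMatrix G A) (i j : Fin N) : 0 ≤ A i j := by
  by_cases h : G.Adj i j
  · exact (hA.pos i j h).le
  · exact (hA.zero i j h).ge

theorem IsAdjacencyMatrix.sum_mul_nonneg (hA : IsAdjacencyMatrix G A) (j : Fin N)
    (v : Fin N → ℝ) : 0 ≤ ∑ i, v i * (∑ k, A i k * (v i - v k) + A i j * v i) := by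
  rw [hA.sum_mul_eq]
  have h1 : 0 ≤ ∑ i, ∑ k, A i k * (v i - v k) ^ 2 := Finset.sum_nonneg fun i _ ↦
    Finset.sum_nonneg fun k _ ↦ mul_nonneg (hA.nonneg i k) (sq_nonneg _)
  have h2 : 0 ≤ ∑ i, A i j * v i ^ 2 :=
    Finset.sum_nonneg fun i _ ↦ mul_nonneg (hA.nonneg i j) (sq_nonneg _)
  positivity

/-- The grounded Laplacian is definite: the form vanishes only if `v` is constant on the connected
graph and zero at a neighbour of `j`, which exists as there are at least two vertices. -/
theorem IsAdjacencyMatrix.eq_zero_of_sum_mul_eq_zero (hN : 2 ≤ N) (hG : G.Connected)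
    (hA : IsAdjacencyMatrix G A) (j : Fin N) {v : Fin N → ℝ}
    (hv : ∑ i, v i * (∑ k, A i k * (v i - v k) + A i j * v i) = 0) : v = 0 := by
  rw [hA.sum_mul_eq] at hv
  have hn1 : ∀ i, 0 ≤ ∑ k, A i k * (v i - v k) ^ 2 := fun i ↦
    Finset.sum_nonneg fun k _ ↦ mul_nonneg (hA.nonneg i k) (sq_nonneg _)
  have hn2 : ∀ i, 0 ≤ A i j * v i ^ 2 := fun i ↦ mul_nonneg (hA.nonneg i j) (sq_nonneg _)
  have h1 : ∑ i, ∑ k, A i k * (v i - v k) ^ 2 = 0 := by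
    have := Finset.sum_nonneg fun i (_ : i ∈ Finset.univ) ↦ hn1 i
    have := Finset.sum_nonneg fun i (_ : i ∈ Finset.univ) ↦ hn2 i
    linarith
  have h2 : ∑ i, A i j * v i ^ 2 = 0 := by linarith
  rw [Finset.sum_eq_zero_iff_of_nonneg fun i _ ↦ hn1 i] at h1
  rw [Finset.sum_eq_zero_iff_of_nonneg fun i _ ↦ hn2 i] at h2
  have hadj : ∀ i k, G.Adj i k → v i = v k := by
    intro i k hik
    have h3 := h1 i (Finset.mem_univ i)
    rw [Finset.sum_eq_zero_iff_of_nonneg fun k _ ↦ mul_nonneg (hA.nonneg i k) (sq_nonneg _)] at h3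
    have h4 := h3 k (Finset.mem_univ k)
    have h5 := (mul_eq_zero.1 h4).resolve_left (hA.pos i k hik).ne'
    exact sub_eq_zero.1 (pow_eq_zero_iff two_ne_zero |>.1 h5)
  have hwalk : ∀ {i k : Fin N} (_ : G.Walk i k), v i = v k := by
    intro i k p
    induction p with
    | nil => rfl
    | cons h _ ih => exact (hadj _ _ h).trans ih
  have : Nontrivial (Fin N) := Fin.nontrivial_iff_two_le.2 hN
  obtain ⟨n, hn⟩ := hG.preconnected.exists_adj_of_nontrivial j
  have h6 := (mul_eq_zero.1 (h2 n (Finset.mem_univ n))).resolve_left (hA.pos n j hn.symm).ne'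
  have h7 : v n = 0 := pow_eq_zero_iff two_ne_zero |>.1 h6
  ext i
  obtain ⟨p⟩ := hG.preconnected i n
  rw [hwalk p, h7, Pi.zero_apply]

/-- Coercivity of the coupling of all the estimation errors. -/
theorem IsAdjacencyMatrix.exists_coercive (hN : 2 ≤ N) (hG : G.Connected)
    (hA : IsAdjacencyMatrix G A) : ∃ c, 0 < c ∧ ∀ w : Fin N → Fin N → ℝ,
      c * ∑ i, ∑ j, w i j ^ 2 ≤
        ∑ i, ∑ j, w i j * (∑ k, A i k * (w i j - w k j) + A i j * w i j) := by
  set Q : (Fin N → Fin N → ℝ) → ℝ := fun w ↦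
    ∑ i, ∑ j, w i j * (∑ k, A i k * (w i j - w k j) + A i j * w i j) with hQ
  obtain ⟨c, hc, hcQ⟩ := exists_mul_sq_norm_le (Q := Q) (by fun_prop) (fun c w ↦ by
      simp only [hQ, Finset.mul_sum, Pi.smul_apply, smul_eq_mul]
      refine Finset.sum_congr rfl fun i _ ↦ Finset.sum_congr rfl fun j _ ↦ ?_
      rw [mul_add, mul_add, mul_add, Finset.mul_sum, Finset.mul_sum, Finset.mul_sum]
      congr 1
      · exact Finset.sum_congr rfl fun k _ ↦ by ring
      · ring) (fun w hw ↦ by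
      have hcol := fun j ↦ hA.sum_mul_nonneg j (fun i ↦ w i j)
      have hQ' : Q w = ∑ j, ∑ i, w i j * (∑ k, A i k * (w i j - w k j) + A i j * w i j) :=
        Finset.sum_comm
      have hnn : 0 ≤ Q w := hQ' ▸ Finset.sum_nonneg fun j _ ↦ hcol j
      refine hnn.lt_of_ne fun h0 ↦ hw ?_
      rw [hQ'] at h0
      have h1 := (Finset.sum_eq_zero_iff_of_nonneg fun j _ ↦ hcol j).1 h0.symm
      ext i j
      exact congrFun (hA.eq_zero_of_sum_mul_eq_zero hN hG j (h1 j (Finset.mem_univ j))) i)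
  have hNpos : (0 : ℝ) < N := by exact_mod_cast (by omega : 0 < N)
  refine ⟨c / N ^ 2, by positivity, fun w ↦ le_trans ?_ (hcQ w)⟩
  have h1 : ∑ i, ∑ j, w i j ^ 2 ≤ ∑ _i : Fin N, ∑ _j : Fin N, ‖w‖ ^ 2 := by
    refine Finset.sum_le_sum fun i _ ↦ Finset.sum_le_sum fun j _ ↦ ?_
    rw [← sq_abs]
    have := (norm_le_pi_norm (w i) j).trans (norm_le_pi_norm w i)
    rw [Real.norm_eq_abs] at this
    gcongr
  simp only [Finset.sum_const, Finset.card_univ, Fintype.card_fin, nsmul_eq_mul] at h1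
  calc c / N ^ 2 * ∑ i, ∑ j, w i j ^ 2 ≤ c / N ^ 2 * (N * (N * ‖w‖ ^ 2)) := by gcongr
    _ = c * ‖w‖ ^ 2 := by field_simp

/-! ### The Lyapunov function of the slow subsystem -/

variable {K : Fin N → ℝ} {θbar : Fin N → Fin N → ℝ} {xs : Fin N → ℝ}

/-- The squared Euclidean norm `|z - xs| ^ 2 + |y - 1 ⊗ z| ^ 2` of the seeking and estimation
errors. -/
def sqError (xs z : Fin N → ℝ) (y : Fin N → Fin N → ℝ) : ℝ :=
  ∑ i, (z i - xs i) ^ 2 + ∑ i, ∑ j, (y i j - z j) ^ 2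

/-- The Lyapunov function of the slow subsystem `(z, y)`. Each square is weighted by the inverse of
its gain, which turns the gains of the dynamics into `1` in the derivative. -/
noncomputable def lyapunov (K : Fin N → ℝ) (θbar : Fin N → Fin N → ℝ) (xs z : Fin N → ℝ)
    (y : Fin N → Fin N → ℝ) : ℝ :=
  (∑ i, (z i - xs i) ^ 2 * (K i)⁻¹ + ∑ i, ∑ j, (y i j - z j) ^ 2 * (θbar i j)⁻¹) / 2

/-- The derivative of `lyapunov`, divided by `θ₁`, along `ż_i = -θ₁ K_i w_i` and the dynamics of the
estimates. The gradient values `w` are left free, so that the formula also covers vector fields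
which agree with the pseudo-gradient only on a bounded set. -/
noncomputable def lyapunovDrift (A : Matrix (Fin N) (Fin N) ℝ) (K : Fin N → ℝ)
    (θbar : Fin N → Fin N → ℝ) (θ : ℝ) (xs w z : Fin N → ℝ) (y : Fin N → Fin N → ℝ) : ℝ :=
  -∑ i, (z i - xs i) * w i
    - θ * ∑ i, ∑ j, (y i j - z j) * (∑ k, A i k * (y i j - y k j) + A i j * (y i j - z j))
    + ∑ i, ∑ j, (y i j - z j) * (K j * (θbar i j)⁻¹ * w j)

theorem exists_pos_bounds {ι : Type*} [Fintype ι] {g : ι → ℝ} (hg : ∀ i, 0 < g i) :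
    ∃ lo hi : ℝ, 0 < lo ∧ 0 < hi ∧ ∀ i, lo ≤ g i ∧ g i ≤ hi := by
  have h1 : ∀ {g : ι → ℝ}, (∀ i, 0 < g i) → 0 < ∑ i, g i + 1 ∧ ∀ i, g i ≤ ∑ i, g i + 1 :=
    fun {g} hg ↦ ⟨by have := Finset.sum_nonneg fun i (_ : i ∈ Finset.univ) ↦ (hg i).le
                     linarith, fun i ↦ by
      have := Finset.single_le_sum (fun i _ ↦ (hg i).le) (Finset.mem_univ i)
      linarith⟩
  have h2 := h1 (g := fun i ↦ (g i)⁻¹) fun i ↦ inv_pos.2 (hg i)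
  exact ⟨(∑ i, (g i)⁻¹ + 1)⁻¹, ∑ i, g i + 1, inv_pos.2 h2.1, (h1 hg).1, fun i ↦
    ⟨inv_le_of_inv_le₀ (hg i) (h2.2 i), (h1 hg).2 i⟩⟩

theorem exists_lyapunov_bounds (hK : ∀ i, 0 < K i) (hθbar : ∀ i j, 0 < θbar i j) :
    ∃ lo hi : ℝ, 0 < lo ∧ 0 < hi ∧ ∀ (xs z : Fin N → ℝ) (y : Fin N → Fin N → ℝ),
      lo * sqError xs z y ≤ lyapunov K θbar xs z y ∧
        lyapunov K θbar xs z y ≤ hi * sqError xs z y := by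
  obtain ⟨lo, hi, hlo, hhi, h⟩ := exists_pos_bounds (g := Sum.elim (fun i ↦ (K i)⁻¹)
    (fun p : Fin N × Fin N ↦ (θbar p.1 p.2)⁻¹)) (by
      rintro (i | p)
      · exact inv_pos.2 (hK i)
      · exact inv_pos.2 (hθbar _ _))
  refine ⟨lo / 2, hi / 2, by positivity, by positivity, fun xs z y ↦ ⟨?_, ?_⟩⟩
  · have h1 : lo * ∑ i, (z i - xs i) ^ 2 ≤ ∑ i, (z i - xs i) ^ 2 * (K i)⁻¹ := by
      rw [Finset.mul_sum]
      refine Finset.sum_le_sum fun i _ ↦ ?_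
      rw [mul_comm]
      have := (h (Sum.inl i)).1
      simp only [Sum.elim_inl] at this
      gcongr
    have h2 : lo * ∑ i, ∑ j, (y i j - z j) ^ 2 ≤
        ∑ i, ∑ j, (y i j - z j) ^ 2 * (θbar i j)⁻¹ := by
      simp only [Finset.mul_sum]
      refine Finset.sum_le_sum fun i _ ↦ Finset.sum_le_sum fun j _ ↦ ?_
      rw [mul_comm]
      have := (h (Sum.inr (i, j))).1
      simp only [Sum.elim_inr] at this
      gcongr
    simp only [lyapunov, sqError]
    linarith
  · have h1 : ∑ i, (z i - xs i) ^ 2 * (K i)⁻¹ ≤ hi * ∑ i, (z i - xs i) ^ 2 := by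
      rw [Finset.mul_sum]
      refine Finset.sum_le_sum fun i _ ↦ ?_
      rw [mul_comm]
      have := (h (Sum.inl i)).2
      simp only [Sum.elim_inl] at this
      gcongr
    have h2 : ∑ i, ∑ j, (y i j - z j) ^ 2 * (θbar i j)⁻¹ ≤
        hi * ∑ i, ∑ j, (y i j - z j) ^ 2 := by
      simp only [Finset.mul_sum]
      refine Finset.sum_le_sum fun i _ ↦ Finset.sum_le_sum fun j _ ↦ ?_
      rw [mul_comm]
      have := (h (Sum.inr (i, j))).2
      simp only [Sum.elim_inr] at this
      gcongr
    simp only [lyapunov, sqError]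
    linarith

theorem hasDerivWithinAt_lyapunov (hK : ∀ i, 0 < K i) (hθbar : ∀ i j, 0 < θbar i j) {θ θ₁ : ℝ}
    {z : ℝ → Fin N → ℝ} {y : ℝ → Fin N → Fin N → ℝ} {w : Fin N → ℝ} {s : Set ℝ} {t : ℝ}
    (hz : HasDerivWithinAt z (fun i ↦ -(θ₁ * K i) * w i) s t)
    (hy : HasDerivWithinAt y (yRate A θbar θ θ₁ (z t) (y t)) s t) :
    HasDerivWithinAt (fun t ↦ lyapunov K θbar xs (z t) (y t))
      (θ₁ * lyapunovDrift A K θbar θ xs w (z t) (y t)) s t := by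
  rw [hasDerivWithinAt_pi] at hz
  have hy' : ∀ i j, HasDerivWithinAt (fun t ↦ y t i j) (yRate A θbar θ θ₁ (z t) (y t) i j) s t :=
    fun i j ↦ hasDerivWithinAt_pi.1 (hasDerivWithinAt_pi.1 hy i) j
  have hE := HasDerivWithinAt.fun_sum fun i (_ : i ∈ Finset.univ) ↦
    (((hz i).sub_const (xs i)).pow 2).mul_const (K i)⁻¹
  have hYi := fun i ↦ HasDerivWithinAt.fun_sum fun j (_ : j ∈ Finset.univ) ↦
    (((hy' i j).sub (hz j)).pow 2).mul_const (θbar i j)⁻¹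
  have hY := HasDerivWithinAt.fun_sum fun i (_ : i ∈ Finset.univ) ↦ hYi i
  have h := (hE.add hY).div_const 2
  refine h.congr_deriv ?_
  rw [lyapunovDrift, add_div, Finset.sum_div, Finset.sum_div, mul_add, mul_sub, mul_neg,
    sub_eq_add_neg, add_assoc, ← mul_assoc]
  simp only [Finset.sum_div, Finset.mul_sum, ← Finset.sum_neg_distrib, ← Finset.sum_add_distrib]
  refine Finset.sum_congr rfl fun i _ ↦ ?_
  congr 1
  · have := (hK i).ne'
    field_simp
    push_cast
    ring
  · refine Finset.sum_congr rfl fun j _ ↦ ?_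
    have := (hθbar i j).ne'
    simp only [yRate]
    set S := ∑ k, A i k * (y t i j - y t k j)
    simp only [Pi.sub_apply]
    field_simp
    push_cast
    ring

/-- The drift of the Lyapunov function on a set where the pseudo-gradient is Lipschitz: strong
monotonicity controls the seeking error, the coupling of the estimates controls the estimation
error, and Young's inequality absorbs the cross terms into a constant that does not depend on
`θ`. -/
theorem exists_lyapunovDrift_le (hK : ∀ i, 0 < K i) (hθbar : ∀ i j, 0 < θbar i j) {m : ℝ}
    (hm : 0 < m) (hmono : StronglyMonotoneWith f m) (hxs : ∀ i, ownPartial f i xs = 0) {a : ℝ}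
    (ha : ∀ w : Fin N → Fin N → ℝ, a * ∑ i, ∑ j, w i j ^ 2 ≤
      ∑ i, ∑ j, w i j * (∑ k, A i k * (w i j - w k j) + A i j * w i j))
    {l : ℝ≥0} {r : ℝ} (hl : ∀ i, LipschitzOnWith l (ownPartial f i) (Metric.closedBall xs r)) :
    ∃ C, ∀ θ, 0 ≤ θ → ∀ (z : Fin N → ℝ) (y : Fin N → Fin N → ℝ), z ∈ Metric.closedBall xs r →
      (∀ i, y i ∈ Metric.closedBall xs r) →
      lyapunovDrift A K θbar θ xs (fun i ↦ ownPartial f i (y i)) z y ≤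
        -(m / 2) * ∑ i, (z i - xs i) ^ 2 + (C - θ * a) * ∑ i, ∑ j, (y i j - z j) ^ 2 := by
  obtain ⟨_, c, _, hc, hKc⟩ := exists_pos_bounds
    (g := fun p : Fin N × Fin N ↦ K p.2 * (θbar p.1 p.2)⁻¹)
    fun p ↦ mul_pos (hK _) (inv_pos.2 (hθbar _ _))
  -- the weight with which the third term may use up the seeking error
  set η : ℝ := m / (4 * ((N : ℝ) ^ 2 * l ^ 2 + 1)) with hη
  have hη0 : 0 < η := by positivity
  refine ⟨N * (l ^ 2 / m) + (1 / 2 + N ^ 2 * (c ^ 2 * l ^ 2 / 2) + c ^ 2 / (4 * η)),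
    fun θ hθ z y hz hy ↦ ?_⟩
  set E := ∑ i, (z i - xs i) ^ 2 with hE
  set Y := ∑ i, ∑ j, (y i j - z j) ^ 2 with hY
  have hxs_mem : xs ∈ Metric.closedBall xs r :=
    Metric.mem_closedBall_self (dist_nonneg.trans (Metric.mem_closedBall.1 hz))
  have sq_lip : ∀ i u, u ∈ Metric.closedBall xs r → ∀ v, v ∈ Metric.closedBall xs r →
      (ownPartial f i u - ownPartial f i v) ^ 2 ≤ l ^ 2 * ∑ j, (u j - v j) ^ 2 := by
    intro i u hu v hv
    have h := (hl i).dist_le_mul u hu v hv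
    rw [Real.dist_eq, dist_eq_norm] at h
    calc (ownPartial f i u - ownPartial f i v) ^ 2
        = |ownPartial f i u - ownPartial f i v| ^ 2 := (sq_abs _).symm
      _ ≤ (l * ‖u - v‖) ^ 2 := by gcongr
      _ = l ^ 2 * ‖u - v‖ ^ 2 := by ring
      _ ≤ _ := by gcongr; exact sq_norm_le_sum_sq (u - v)
  have hYi : ∀ i, ∑ j, (y i j - z j) ^ 2 ≤ Y := fun i ↦
    Finset.single_le_sum (f := fun i ↦ ∑ j, (y i j - z j) ^ 2)
      (fun i _ ↦ Finset.sum_nonneg fun j _ ↦ sq_nonneg _) (Finset.mem_univ i)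
  have hyz : ∀ i, (ownPartial f i (y i) - ownPartial f i z) ^ 2 ≤ l ^ 2 * Y := fun i ↦
    (sq_lip i _ (hy i) z hz).trans (by gcongr; exact hYi i)
  have hzx : ∀ i, ownPartial f i z ^ 2 ≤ l ^ 2 * E := fun i ↦ by
    simpa [hxs] using sq_lip i z hz xs hxs_mem
  have t1 : -∑ i, (z i - xs i) * ownPartial f i (y i) ≤
      -(3 * m / 4) * E + N * (l ^ 2 / m) * Y := by
    have h := hmono z xs
    simp only [hxs, sub_zero] at h
    have h2 : ∑ i, (z i - xs i) * (ownPartial f i z - ownPartial f i (y i)) ≤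
        ∑ i, (m / 4 * (z i - xs i) ^ 2 + l ^ 2 / m * Y) := by
      refine Finset.sum_le_sum fun i _ ↦ ?_
      have h3 := hyz i
      set u := ownPartial f i z - ownPartial f i (y i) with hu
      have h4 : u ^ 2 ≤ l ^ 2 * Y := by rw [hu]; nlinarith
      have h5 : (z i - xs i) * u ≤ m / 4 * (z i - xs i) ^ 2 + u ^ 2 / m := by
        have h6 : u ^ 2 / m * m = u ^ 2 := by field_simp
        have h7 : 0 ≤ (m / 2 * (z i - xs i) - u) ^ 2 := sq_nonneg _
        refine le_of_mul_le_mul_right ?_ hm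
        nlinarith
      have h8 : u ^ 2 / m ≤ l ^ 2 * Y / m := by gcongr
      rw [mul_div_right_comm] at h8
      linarith
    rw [Finset.sum_add_distrib, ← Finset.mul_sum, ← hE] at h2
    simp only [Finset.sum_const, Finset.card_univ, Fintype.card_fin, nsmul_eq_mul, mul_sub,
      Finset.sum_sub_distrib] at h2
    linarith
  have t2 : -(θ * ∑ i, ∑ j, (y i j - z j) *
      (∑ k, A i k * (y i j - y k j) + A i j * (y i j - z j))) ≤ -(θ * (a * Y)) := by
    have h := ha fun i j ↦ y i j - z j
    simp only [sub_sub_sub_cancel_right] at h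
    gcongr
  have t3 : ∑ i, ∑ j, (y i j - z j) * (K j * (θbar i j)⁻¹ * ownPartial f j (y j)) ≤
      m / 4 * E + (1 / 2 + N ^ 2 * (c ^ 2 * l ^ 2 / 2) + c ^ 2 / (4 * η)) * Y := by
    have h : ∑ i, ∑ j, (y i j - z j) * (K j * (θbar i j)⁻¹ * ownPartial f j (y j)) ≤
        ∑ i : Fin N, ∑ j, ((1 / 2 + c ^ 2 / (4 * η)) * (y i j - z j) ^ 2 +
          (c ^ 2 * l ^ 2 / 2 * Y + η * (l ^ 2 * E))) := by
      refine Finset.sum_le_sum fun i _ ↦ Finset.sum_le_sum fun j _ ↦ ?_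
      have h1 := hyz j
      have h2 := hzx j
      have h3 := (hKc (i, j)).2
      have h4 : 0 < K j * (θbar i j)⁻¹ := mul_pos (hK j) (inv_pos.2 (hθbar i j))
      simp only at h3
      set κ := K j * (θbar i j)⁻¹
      set v := ownPartial f j z
      set u := ownPartial f j (y j) - v with hu
      have e : ownPartial f j (y j) = u + v := by rw [hu]; ring
      rw [e]
      set e := y i j - z j
      have hκ : κ ^ 2 ≤ c ^ 2 := by gcongr
      have h5 : e * (κ * u) ≤ 1 / 2 * e ^ 2 + c ^ 2 * (l ^ 2 * Y) / 2 := by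
        have h6 : (κ * u) ^ 2 ≤ c ^ 2 * (l ^ 2 * Y) := by rw [mul_pow]; gcongr
        nlinarith [sq_nonneg (e - κ * u)]
      have h7 : e * (κ * v) ≤ c ^ 2 / (4 * η) * e ^ 2 + η * (l ^ 2 * E) := by
        have h8 : e * (κ * v) ≤ κ ^ 2 / (4 * η) * e ^ 2 + η * v ^ 2 := by
          have h9 : κ ^ 2 / (4 * η) * e ^ 2 * (4 * η) = κ ^ 2 * e ^ 2 := by field_simp
          refine le_of_mul_le_mul_right ?_ (by positivity : 0 < 4 * η)
          nlinarith [sq_nonneg (κ * e - 2 * η * v)]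
        refine h8.trans ?_
        gcongr
      nlinarith
    refine h.trans ?_
    simp only [Finset.sum_add_distrib, ← Finset.mul_sum, Finset.sum_const, Finset.card_univ,
      Fintype.card_fin, nsmul_eq_mul]
    rw [← hY]
    have h10 : (N : ℝ) ^ 2 * (η * (l ^ 2 * E)) ≤ m / 4 * E := by
      have hE0 : 0 ≤ E := Finset.sum_nonneg fun i _ ↦ sq_nonneg _
      have h11 : (N : ℝ) ^ 2 * l ^ 2 * η ≤ m / 4 := by
        rw [hη, mul_div_assoc', div_le_div_iff₀ (by positivity) (by positivity)]
        nlinarith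
      nlinarith
    nlinarith
  rw [lyapunovDrift]
  linarith

theorem dist_le_of_sqError_le {xs z : Fin N → ℝ} {y : Fin N → Fin N → ℝ} {ρ : ℝ} (hρ : 0 ≤ ρ)
    (h : sqError xs z y ≤ ρ ^ 2) : dist z xs ≤ ρ ∧ (∀ i, dist (y i) xs ≤ 2 * ρ) ∧
      ‖(fun i j ↦ y i j - z j)‖ ≤ ρ := by
  have hE : 0 ≤ ∑ i, (z i - xs i) ^ 2 := Finset.sum_nonneg fun i _ ↦ sq_nonneg _
  have hYi : ∀ i, 0 ≤ ∑ j, (y i j - z j) ^ 2 := fun i ↦ Finset.sum_nonneg fun j _ ↦ sq_nonneg _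
  have hY : 0 ≤ ∑ i, ∑ j, (y i j - z j) ^ 2 := Finset.sum_nonneg fun i _ ↦ hYi i
  rw [sqError] at h
  have h1 : dist z xs ≤ ρ := by
    rw [dist_eq_norm]
    refine abs_le_of_sq_le_sq' ?_ hρ |>.2
    exact (sq_norm_le_sum_sq (z - xs)).trans (by simp only [Pi.sub_apply]; linarith)
  have h2 : ∀ i, ‖fun j ↦ y i j - z j‖ ≤ ρ := fun i ↦ by
    refine abs_le_of_sq_le_sq' ?_ hρ |>.2
    have := Finset.single_le_sum (fun i _ ↦ hYi i) (Finset.mem_univ i)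
    exact (sq_norm_le_sum_sq _).trans (by linarith)
  refine ⟨h1, fun i ↦ ?_, (pi_norm_le_iff_of_nonneg hρ).2 h2⟩
  have h3 : dist (y i) z ≤ ρ := by
    rw [dist_eq_norm]
    exact h2 i
  linarith [dist_triangle (y i) z xs]

/-- On a sublevel set of the Lyapunov function, a large coupling gain `θ` makes the drift
proportional to the function itself. The threshold depends on the level through the Lipschitz
constant of the pseudo-gradient. -/
theorem exists_gain (hN : 2 ≤ N) (hf : ∀ i, ContDiff ℝ 2 (f i)) (hG : G.Connected)
    (hA : IsAdjacencyMatrix G A) {m : ℝ} (hm : 0 < m) (hmono : StronglyMonotoneWith f m)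
    (hK : ∀ i, 0 < K i) (hθbar : ∀ i j, 0 < θbar i j) (hxs : ∀ i, ownPartial f i xs = 0)
    (R : ℝ) :
    ∃ θs γ r : ℝ, 0 < θs ∧ 0 < γ ∧ ∀ (z : Fin N → ℝ) (y : Fin N → Fin N → ℝ),
      lyapunov K θbar xs z y ≤ R → (∀ i, y i ∈ Metric.closedBall xs r) ∧
        ∀ θ, θs < θ → lyapunovDrift A K θbar θ xs (fun i ↦ ownPartial f i (y i)) z y ≤
          -γ * lyapunov K θbar xs z y := by
  obtain ⟨lo, hi, hlo, hhi, hV⟩ := exists_lyapunov_bounds hK hθbar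
  obtain ⟨a, ha0, ha⟩ := hA.exists_coercive hN hG
  set ρ := √(R / lo)
  obtain ⟨l, hl⟩ := exists_lipschitz_ownPartial hf xs (2 * ρ)
  obtain ⟨C, hC⟩ := exists_lyapunovDrift_le hK hθbar hm hmono hxs ha fun i ↦ (hl i).1
  refine ⟨(|C| + 1) / a, min (m / 2) 1 / hi, 2 * ρ, by positivity, by positivity,
    fun z y hR ↦ ?_⟩
  have hsq : sqError xs z y ≤ ρ ^ 2 := by
    have h1 : sqError xs z y ≤ R / lo := by
      rw [le_div_iff₀ hlo, mul_comm]
      exact (hV xs z y).1.trans hR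
    refine h1.trans ?_
    rw [Real.sq_sqrt']
    exact le_max_left _ _
  have hρ : 0 ≤ ρ := Real.sqrt_nonneg _
  obtain ⟨hz, hy, -⟩ := dist_le_of_sqError_le hρ hsq
  refine ⟨hy, fun θ hθ ↦ ?_⟩
  have hθa : |C| + 1 < θ * a := (div_lt_iff₀ ha0).1 hθ
  have hθ0 : 0 ≤ θ := le_trans (by positivity) hθ.le
  refine (hC θ hθ0 z y (Metric.mem_closedBall.2 (hz.trans (by linarith))) hy).trans ?_
  have hE : 0 ≤ ∑ i, (z i - xs i) ^ 2 := Finset.sum_nonneg fun i _ ↦ sq_nonneg _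
  have hY : 0 ≤ ∑ i, ∑ j, (y i j - z j) ^ 2 :=
    Finset.sum_nonneg fun i _ ↦ Finset.sum_nonneg fun j _ ↦ sq_nonneg _
  have h2 : min (m / 2) 1 / hi * lyapunov K θbar xs z y ≤
      min (m / 2) 1 / hi * (hi * sqError xs z y) := by
    have := (hV xs z y).2
    gcongr
  have h3 : min (m / 2) 1 / hi * (hi * sqError xs z y) = min (m / 2) 1 * sqError xs z y := by
    field_simp
  have h4 : (C - θ * a) * ∑ i, ∑ j, (y i j - z j) ^ 2 ≤ -1 * ∑ i, ∑ j, (y i j - z j) ^ 2 := by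
    gcongr
    linarith [le_abs_self C]
  have h5 : min (m / 2) 1 * ∑ i, (z i - xs i) ^ 2 ≤ m / 2 * ∑ i, (z i - xs i) ^ 2 := by
    gcongr
    exact min_le_left _ _
  have h6 : min (m / 2) 1 * ∑ i, ∑ j, (y i j - z j) ^ 2 ≤
      1 * ∑ i, ∑ j, (y i j - z j) ^ 2 := by
    gcongr
    exact min_le_right _ _
  rw [h3, sqError, mul_add] at h2
  linarith

/-- A sublevel set of the Lyapunov function is invariant, and the function decays exponentially on
it. Only inside the sublevel set do the gradient values `w` have to be those of the game. -/
theorem lyapunov_le_exp (hK : ∀ i, 0 < K i) (hθbar : ∀ i j, 0 < θbar i j) {θ θ₁ γ R : ℝ}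
    (hθ₁ : 0 < θ₁) (hγ : 0 < γ) (hR : 0 < R)
    (hdrift : ∀ (z : Fin N → ℝ) (y : Fin N → Fin N → ℝ), lyapunov K θbar xs z y ≤ R →
      lyapunovDrift A K θbar θ xs (fun i ↦ ownPartial f i (y i)) z y ≤
        -γ * lyapunov K θbar xs z y)
    {z w : ℝ → Fin N → ℝ} {y : ℝ → Fin N → Fin N → ℝ}
    (hz : ∀ t, 0 ≤ t → HasDerivWithinAt z (fun i ↦ -(θ₁ * K i) * w t i) (Ici 0) t)
    (hy : ∀ t, 0 ≤ t → HasDerivWithinAt y (yRate A θbar θ θ₁ (z t) (y t)) (Ici 0) t)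
    (hw : ∀ t, lyapunov K θbar xs (z t) (y t) ≤ R → ∀ i, w t i = ownPartial f i (y t i))
    (h0 : lyapunov K θbar xs (z 0) (y 0) ≤ R) :
    ∀ t, 0 ≤ t → lyapunov K θbar xs (z t) (y t) ≤ R * Real.exp (-(θ₁ * γ / 2 * t)) := by
  refine le_of_deriv_lt_at_contact
    (fun t ht ↦ hasDerivWithinAt_lyapunov hK hθbar (hz t ht) (hy t ht))
    (hasDerivAt_const_mul_exp_neg R (θ₁ * γ / 2)) (by simpa using h0) fun t ht heq ↦ ?_
  have hpos : 0 < R * Real.exp (-(θ₁ * γ / 2 * t)) := by positivity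
  have hle : lyapunov K θbar xs (z t) (y t) ≤ R := by
    rw [heq]
    have : Real.exp (-(θ₁ * γ / 2 * t)) ≤ 1 := by
      rw [Real.exp_le_one_iff, neg_nonpos]
      positivity
    nlinarith
  have h := hdrift _ _ hle
  rw [← funext (hw t hle), heq] at h
  have h2 := mul_le_mul_of_nonneg_left h hθ₁.le
  have h3 : 0 < θ₁ * γ * (R * Real.exp (-(θ₁ * γ / 2 * t))) := by positivity
  linarith

/-! ### Solutions of the closed loop and their convergence -/

/-- The estimates are driven linearly by the estimation error `y - 1 ⊗ z`. -/
theorem exists_yRate_eq_clm (A : Matrix (Fin N) (Fin N) ℝ) (θbar : Fin N → Fin N → ℝ)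
    (θ θ₁ : ℝ) : ∃ T : (Fin N → Fin N → ℝ) →L[ℝ] (Fin N → Fin N → ℝ),
      ∀ z y, yRate A θbar θ θ₁ z y = T fun i j ↦ y i j - z j := by
  let T : (Fin N → Fin N → ℝ) →ₗ[ℝ] (Fin N → Fin N → ℝ) :=
    { toFun := fun w i j ↦ -(θ * θ₁ * θbar i j) * (∑ k, A i k * (w i j - w k j) + A i j * w i j)
      map_add' := fun v w ↦ by
        ext i j
        simp only [Pi.add_apply]
        rw [← mul_add, show ∀ a b c d : ℝ, a + b + (c + d) = a + c + (b + d) by intros; ring,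
          ← Finset.sum_add_distrib, ← mul_add]
        congr 2
        exact Finset.sum_congr rfl fun k _ ↦ by ring
      map_smul' := fun c w ↦ by
        ext i j
        simp only [Pi.smul_apply, smul_eq_mul, RingHom.id_apply]
        rw [mul_left_comm c, mul_add c, Finset.mul_sum]
        congr 2
        · exact Finset.sum_congr rfl fun k _ ↦ by ring
        · ring }
  refine ⟨LinearMap.toContinuousLinearMap T, fun z y ↦ ?_⟩
  ext i j
  simp [T, yRate]

theorem exists_lipschitzWith_pi {E ι : Type*} [PseudoMetricSpace E] [Fintype ι]
    {α : ι → Type*} [∀ i, PseudoMetricSpace (α i)] {F : E → ∀ i, α i}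
    (hF : ∀ i, ∃ L : ℝ≥0, LipschitzWith L fun p ↦ F p i) : ∃ L : ℝ≥0, LipschitzWith L F := by
  choose L hL using hF
  refine ⟨∑ i, L i, LipschitzWith.of_dist_le_mul fun p q ↦ ?_⟩
  rw [dist_pi_le_iff (by positivity)]
  intro i
  refine ((hL i).dist_le_mul p q).trans ?_
  gcongr
  exact Finset.single_le_sum (f := L) (fun _ _ ↦ zero_le) (Finset.mem_univ i)

theorem hasDerivWithinAt_fst_snd {E F : Type*} [NormedAddCommGroup E] [NormedSpace ℝ E]
    [NormedAddCommGroup F] [NormedSpace ℝ F] {α : ℝ → E × F} {α' : E × F} {s : Set ℝ} {t : ℝ}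
    (h : HasDerivWithinAt α α' s t) :
    HasDerivWithinAt (fun t ↦ (α t).1) α'.1 s t ∧ HasDerivWithinAt (fun t ↦ (α t).2) α'.2 s t :=
  ⟨(ContinuousLinearMap.fst ℝ E F).hasFDerivAt.comp_hasDerivWithinAt t h,
    (ContinuousLinearMap.snd ℝ E F).hasFDerivAt.comp_hasDerivWithinAt t h⟩

/-- The closed loop with the gradients replaced by globally Lipschitz functions `g` has solutions on
the half-line. -/
theorem exists_solution_of_lipschitz_gradients {g : Fin N → (Fin N → ℝ) → ℝ} {l : ℝ≥0}
    (hg : ∀ i, LipschitzWith l (g i)) {U : ℝ} (hU : 0 < U) (K : Fin N → ℝ)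
    (A : Matrix (Fin N) (Fin N) ℝ) (θbar : Fin N → Fin N → ℝ) (θ θ₁ : ℝ)
    (x₀ ν₀ z₀ : Fin N → ℝ) (y₀ : Fin N → Fin N → ℝ) :
    ∃ (x ν z : ℝ → Fin N → ℝ) (y : ℝ → Fin N → Fin N → ℝ),
      (∀ t, 0 ≤ t → HasDerivWithinAt x (ν t) (Ici 0) t) ∧
      (∀ t, 0 ≤ t → HasDerivWithinAt ν (fun i ↦
        -sat U ((x t i - z t i) + (ν t i - -(θ₁ * K i) * g i (y t i)))) (Ici 0) t) ∧
      (∀ t, 0 ≤ t → HasDerivWithinAt z (fun i ↦ -(θ₁ * K i) * g i (y t i)) (Ici 0) t) ∧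
      (∀ t, 0 ≤ t → HasDerivWithinAt y (yRate A θbar θ θ₁ (z t) (y t)) (Ici 0) t) ∧
      x 0 = x₀ ∧ ν 0 = ν₀ ∧ z 0 = z₀ ∧ y 0 = y₀ := by
  obtain ⟨T, hT⟩ := exists_yRate_eq_clm A θbar θ θ₁
  let E := (Fin N → ℝ) × (Fin N → ℝ) × (Fin N → ℝ) × (Fin N → Fin N → ℝ)
  let F : E → E := fun p ↦ (p.2.1,
    fun i ↦ -sat U ((p.1 i - p.2.2.1 i) + (p.2.1 i - -(θ₁ * K i) * g i (p.2.2.2 i))),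
    fun i ↦ -(θ₁ * K i) * g i (p.2.2.2 i), yRate A θbar θ θ₁ p.2.2.1 p.2.2.2)
  have hx : LipschitzWith 1 fun p : E ↦ p.1 := LipschitzWith.prod_fst
  have hν := LipschitzWith.prod_fst.comp (LipschitzWith.prod_snd (α := Fin N → ℝ)
    (β := (Fin N → ℝ) × (Fin N → ℝ) × (Fin N → Fin N → ℝ)))
  have hzy := LipschitzWith.prod_snd.comp (LipschitzWith.prod_snd (α := Fin N → ℝ)
    (β := (Fin N → ℝ) × (Fin N → ℝ) × (Fin N → Fin N → ℝ)))
  have hz := LipschitzWith.prod_fst.comp hzy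
  have hy := LipschitzWith.prod_snd.comp hzy
  have hzr : ∀ i, ∃ L : ℝ≥0, LipschitzWith L fun p : E ↦ -(θ₁ * K i) * g i (p.2.2.2 i) := fun i ↦
    ⟨_, (lipschitzWith_smul (-(θ₁ * K i))).comp ((hg i).comp ((LipschitzWith.eval i).comp hy))⟩
  have hu : ∀ i, ∃ L : ℝ≥0, LipschitzWith L fun p : E ↦
      -sat U ((p.1 i - p.2.2.1 i) + (p.2.1 i - -(θ₁ * K i) * g i (p.2.2.2 i))) := fun i ↦ by
    obtain ⟨L, hL⟩ := hzr i
    exact ⟨_, ((lipschitzWith_sat hU).comp ((((LipschitzWith.eval i).comp hx).sub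
      ((LipschitzWith.eval i).comp hz)).add (((LipschitzWith.eval i).comp hν).sub hL))).neg⟩
  have hyr : ∃ L : ℝ≥0, LipschitzWith L fun p : E ↦ yRate A θbar θ θ₁ p.2.2.1 p.2.2.2 := by
    simp only [hT]
    obtain ⟨L, hL⟩ : ∃ L : ℝ≥0, LipschitzWith L fun p : E ↦ fun i j ↦ p.2.2.2 i j - p.2.2.1 j :=
      exists_lipschitzWith_pi fun i ↦ exists_lipschitzWith_pi fun j ↦
        ⟨_, ((LipschitzWith.eval j).comp ((LipschitzWith.eval i).comp hy)).sub
          ((LipschitzWith.eval j).comp hz)⟩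
    exact ⟨_, T.lipschitz.comp hL⟩
  obtain ⟨L₂, hL₂⟩ := exists_lipschitzWith_pi hu
  obtain ⟨L₃, hL₃⟩ := exists_lipschitzWith_pi hzr
  obtain ⟨L₄, hL₄⟩ := hyr
  have hF := hν.prodMk (hL₂.prodMk (hL₃.prodMk hL₄))
  obtain ⟨α, hα0, hα⟩ := exists_solution_of_lipschitzWith (F := F) hF (x₀, ν₀, z₀, y₀)
  have h₁ := fun t ht ↦ hasDerivWithinAt_fst_snd (hα t ht)
  have h₂ := fun t ht ↦ hasDerivWithinAt_fst_snd (h₁ t ht).2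
  have h₃ := fun t ht ↦ hasDerivWithinAt_fst_snd (h₂ t ht).2
  refine ⟨fun t ↦ (α t).1, fun t ↦ (α t).2.1, fun t ↦ (α t).2.2.1, fun t ↦ (α t).2.2.2,
    fun t ht ↦ (h₁ t ht).1, fun t ht ↦ (h₂ t ht).1, fun t ht ↦ (h₃ t ht).1,
    fun t ht ↦ (h₃ t ht).2, ?_⟩
  simp [hα0]

/-- Along a solution on which the Lyapunov function of the slow subsystem decays exponentially, the
actions converge to `xs`: the commanded acceleration `z̈` is then an exponentially decaying
disturbance of the double integrator with state `(x - z, ν - ż)`. -/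
theorem IsSolution.tendsto (hf : ∀ i, ContDiff ℝ 2 (f i)) (hK : ∀ i, 0 < K i)
    (hθbar : ∀ i j, 0 < θbar i j) {U θ θ₁ R c : ℝ} (hU : 0 < U) (hc : 0 < c) (hR : 0 < R)
    {x ν z : ℝ → Fin N → ℝ} {y : ℝ → Fin N → Fin N → ℝ}
    (h : IsSolution f A K θbar U θ θ₁ x ν z y)
    (hV : ∀ t, 0 ≤ t → lyapunov K θbar xs (z t) (y t) ≤ R * Real.exp (-(c * t))) :
    Tendsto x atTop (𝓝 xs) := by
  obtain ⟨lo, _, hlo, _, hlb⟩ := exists_lyapunov_bounds hK hθbar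
  obtain ⟨T, hT⟩ := exists_yRate_eq_clm A θbar θ θ₁
  set ρ := √(R / lo) with hρ
  have hρ0 : 0 ≤ ρ := Real.sqrt_nonneg _
  have hsq : ∀ t, 0 ≤ t → sqError xs (z t) (y t) ≤ (ρ * Real.exp (-(c / 2 * t))) ^ 2 := by
    intro t ht
    have h1 := (hlb xs (z t) (y t)).1.trans (hV t ht)
    rw [mul_pow, hρ, Real.sq_sqrt (by positivity), ← Real.exp_nat_mul, div_mul_eq_mul_div,
      le_div_iff₀ hlo, mul_comm]
    refine h1.trans_eq ?_
    congr 2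
    push_cast
    ring
  have hdist := fun t ht ↦ dist_le_of_sqError_le (by positivity) (hsq t ht)
  have hexp : ∀ t, 0 ≤ t → Real.exp (-(c / 2 * t)) ≤ 1 := fun t ht ↦ by
    rw [Real.exp_le_one_iff, neg_nonpos]
    positivity
  obtain ⟨l, hl⟩ := exists_lipschitz_ownPartial hf xs (2 * ρ)
  have hz : Tendsto z atTop (𝓝 xs) := by
    rw [tendsto_iff_dist_tendsto_zero]
    refine squeeze_zero' (Eventually.of_forall fun t ↦ dist_nonneg) ?_
      (tendsto_const_mul_exp_neg ρ (half_pos hc))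
    filter_upwards [eventually_ge_atTop 0] with t ht using (hdist t ht).1
  have hxz : ∀ i, Tendsto (fun t ↦ x t i - z t i) atTop (𝓝 0) := by
    intro i
    have hrate : ∀ t, 0 ≤ t → HasDerivWithinAt (fun t ↦ zRate f K θ₁ (y t) i)
        (-(θ₁ * K i) * fderiv ℝ (ownPartial f i) (y t i) (yRate A θbar θ θ₁ (z t) (y t) i))
        (Ici 0) t := fun t ht ↦ by
      have h1 := hasDerivWithinAt_pi.1 (h.hasDeriv_y t ht) i
      have h2 := ((contDiff_ownPartial hf i).differentiable one_ne_zero (y t i)).hasFDerivAt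
      exact (h2.comp_hasDerivWithinAt t h1).const_mul (-(θ₁ * K i))
    refine tendsto_zero_of_saturated_double_integrator (q := fun t ↦ ν t i - zRate f K θ₁ (y t) i)
      (D := |θ₁ * K i| * (l * (‖T‖ * ρ))) hU (half_pos hc)
      (fun t ht ↦ (hasDerivWithinAt_pi.1 (h.hasDeriv_x t ht) i).sub
        (hasDerivWithinAt_pi.1 (h.hasDeriv_z t ht) i))
      (fun t ht ↦ (hasDerivWithinAt_pi.1 (h.hasDeriv_ν t ht) i).sub (hrate t ht))
      (fun t ht ↦ ?_)
    have hmem : y t i ∈ Metric.closedBall xs (2 * ρ) := by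
      have := (hdist t ht).2.1 i
      have := mul_le_mul_of_nonneg_left (hexp t ht) hρ0
      rw [Metric.mem_closedBall]
      linarith
    have h3 : ‖yRate A θbar θ θ₁ (z t) (y t) i‖ ≤ ‖T‖ * (ρ * Real.exp (-(c / 2 * t))) := by
      rw [hT]
      refine (norm_le_pi_norm _ i).trans ((T.le_opNorm _).trans ?_)
      gcongr
      exact (hdist t ht).2.2
    have h4 : ‖fderiv ℝ (ownPartial f i) (y t i) (yRate A θbar θ θ₁ (z t) (y t) i)‖ ≤
        l * (‖T‖ * (ρ * Real.exp (-(c / 2 * t)))) := by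
      refine (ContinuousLinearMap.le_opNorm _ _).trans ?_
      have := (hl i).2 _ hmem
      gcongr
    rw [abs_mul, abs_neg]
    rw [Real.norm_eq_abs] at h4
    calc _ ≤ |θ₁ * K i| * (l * (‖T‖ * (ρ * Real.exp (-(c / 2 * t))))) := by gcongr
      _ = _ := by ring
  rw [tendsto_pi_nhds]
  intro i
  simpa using (hxz i).add (tendsto_pi_nhds.1 hz i)

theorem sqError_le_of_errorNorm_le {θ₁ Δ : ℝ} {x ν z : Fin N → ℝ} {y : Fin N → Fin N → ℝ}
    (h : errorNorm f K θ₁ xs x ν z y ≤ Δ) : sqError xs z y ≤ Δ ^ 2 := by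
  have h1 : 0 ≤ ∑ i, (ν i - zRate f K θ₁ y i) ^ 2 := Finset.sum_nonneg fun i _ ↦ sq_nonneg _
  have h2 : 0 ≤ ∑ i, (x i - z i) ^ 2 := Finset.sum_nonneg fun i _ ↦ sq_nonneg _
  have h3 := Real.sqrt_le_left ((Real.sqrt_nonneg _).trans h) |>.1 h
  rw [sqError]
  linarith

end BoundedNash

theorem theorem5 {N : ℕ} (hN : 2 ≤ N)
    (f : Fin N → (Fin N → ℝ) → ℝ) (hf : ∀ i, ContDiff ℝ 2 (f i))
    (G : SimpleGraph (Fin N)) (hG : G.Connected)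
    (A : Matrix (Fin N) (Fin N) ℝ) (hA : BoundedNash.IsAdjacencyMatrix G A)
    (hmono : ∃ m : ℝ, 0 < m ∧ BoundedNash.StronglyMonotoneWith f m)
    (U : ℝ) (hU : 0 < U)
    (K : Fin N → ℝ) (hK : ∀ i, 0 < K i)
    (θbar : Fin N → Fin N → ℝ) (hθbar : ∀ i j, 0 < θbar i j) :
    ∃ xs : Fin N → ℝ,
      BoundedNash.IsNashEquilibrium f xs ∧
      (∀ x' : Fin N → ℝ, BoundedNash.IsNashEquilibrium f x' → x' = xs) ∧
      ∀ Δ : ℝ, 0 < Δ →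
        ∃ θs : ℝ, 0 < θs ∧ ∀ θ : ℝ, θs < θ →
          ∃ θ₁s : ℝ, 0 < θ₁s ∧ ∀ θ₁ : ℝ, 0 < θ₁ → θ₁ < θ₁s →
            ∀ (x₀ ν₀ z₀ : Fin N → ℝ) (y₀ : Fin N → Fin N → ℝ),
              BoundedNash.errorNorm f K θ₁ xs x₀ ν₀ z₀ y₀ ≤ Δ →
              (∃ (x ν z : ℝ → Fin N → ℝ) (y : ℝ → Fin N → Fin N → ℝ),
                BoundedNash.IsSolution f A K θbar U θ θ₁ x ν z y ∧
                x 0 = x₀ ∧ ν 0 = ν₀ ∧ z 0 = z₀ ∧ y 0 = y₀) ∧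
              (∀ (x ν z : ℝ → Fin N → ℝ) (y : ℝ → Fin N → Fin N → ℝ),
                BoundedNash.IsSolution f A K θbar U θ θ₁ x ν z y →
                x 0 = x₀ → ν 0 = ν₀ → z 0 = z₀ → y 0 = y₀ →
                Filter.Tendsto x Filter.atTop (nhds xs)) := by
  open BoundedNash in
  obtain ⟨m, hm, hmono⟩ := hmono
  obtain ⟨xs, hxs⟩ := exists_ownPartial_eq_zero hf hm hmono
  refine ⟨xs, isNashEquilibrium_of_ownPartial_eq_zero hf hm hmono hxs, fun x' hx' ↦
    eq_of_ownPartial_eq_zero hm hmono (ownPartial_eq_zero_of_isNashEquilibrium hx') hxs,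
    fun Δ hΔ ↦ ?_⟩
  obtain ⟨_, hi, _, hhi, hub⟩ := exists_lyapunov_bounds hK hθbar
  -- the level of a sublevel set that contains all the admitted initial states
  set R := hi * Δ ^ 2
  have hR : 0 < R := by positivity
  obtain ⟨θs, γ, r, hθs, hγ, hgain⟩ := exists_gain hN hf hG hA hm hmono hK hθbar hxs R
  -- The damping of the saturated loop absorbs every exponentially decaying acceleration, whatever
  -- its size, so the time scale `θ₁` is not restricted and `1` serves as the threshold.
  refine ⟨θs, hθs, fun θ hθ ↦ ⟨1, one_pos, fun θ₁ hθ₁ _ x₀ ν₀ z₀ y₀ hinit ↦ ?_⟩⟩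
  have h0 : lyapunov K θbar xs z₀ y₀ ≤ R := by
    refine (hub xs z₀ y₀).2.trans ?_
    exact mul_le_mul_of_nonneg_left (sqError_le_of_errorNorm_le hinit) hhi.le
  have hc : 0 < θ₁ * γ / 2 := by positivity
  refine ⟨?_, fun x ν z y hsol _ _ hz0 hy0 ↦ ?_⟩
  · obtain ⟨l, hl⟩ := exists_lipschitz_ownPartial hf xs r
    choose g hgl hg using fun i ↦ (hl i).1.extend_real
    obtain ⟨x, ν, z, y, hx, hν, hz, hy, hx0, hν0, hz0, hy0⟩ :=
      exists_solution_of_lipschitz_gradients hgl hU K A θbar θ θ₁ x₀ ν₀ z₀ y₀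
    have hgr : ∀ t, lyapunov K θbar xs (z t) (y t) ≤ R →
        ∀ i, g i (y t i) = ownPartial f i (y t i) := fun t ht i ↦ (hg i ((hgain _ _ ht).1 i)).symm
    have hV := lyapunov_le_exp (w := fun t i ↦ g i (y t i)) hK hθbar hθ₁ hγ hR
      (fun z y h ↦ (hgain z y h).2 θ hθ) hz hy hgr (by rwa [hz0, hy0])
    have hg' : ∀ t, 0 ≤ t → ∀ i, g i (y t i) = ownPartial f i (y t i) := fun t ht ↦ by
      refine hgr t ((hV t ht).trans ?_)
      have : Real.exp (-(θ₁ * γ / 2 * t)) ≤ 1 := by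
        rw [Real.exp_le_one_iff, neg_nonpos]
        positivity
      nlinarith
    refine ⟨x, ν, z, y, ⟨hx, fun t ht ↦ ?_, fun t ht ↦ ?_, hy⟩, hx0, hν0, hz0, hy0⟩
    · have h1 := hν t ht
      simp only [hg' t ht] at h1
      exact h1
    · have h1 := hz t ht
      simp only [hg' t ht] at h1
      exact h1
  · exact hsol.tendsto hf hK hθbar hU hc hR
      (lyapunov_le_exp (w := fun t i ↦ ownPartial f i (y t i)) hK hθbar hθ₁ hγ hR
        (fun z y h ↦ (hgain z y h).2 θ hθ) hsol.hasDeriv_z hsol.hasDeriv_y (fun _ _ _ ↦ rfl)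
        (by rwa [hz0, hy0]))
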